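/- Let $N\ge 0$ be an integer. Order the $2N$ vertices by $1<2<\dots<N<\overline N<\dots<\overline 2<\overline 1$ and put $|a|=|\overline a|=a$. An *Okada arc-diagram* of rank $N$ is a non-crossing perfect matching of these vertices in which every arc $\{a,b\}$ carries a height label $h(a,b)$ such that (1) $1\le h(a,b)\le\min(|a|,|b|)$; (2) $h(a,b)\equiv\min(|a|,|b|)\pmod 2$; (3) $h(a,b)>h(c,d)$ whenever $c<a<b<d$. The *Okada monoid* $O_N$ is the set of these diagrams, where the product of $C$ and $D$ is obtained by merging the vertex $\overline a$ of $C$ with the vertex $a$ of $D$ for each $a$, concatenating arcs, labelling each resulting arc by the minimum of the labels of the arcs that compose it, and deleting closed loops; the unit consists of the arcs $\{a,\overline a\}$ with label $a$. The *mirror* of a diagram is obtained by exchanging $a$ and $\overline a$ for all $a$; an element is *involutive* if it equals its mirror. The *propagating set* of a diagram is the set of labels of its arcs joining some $a$ to some $\overline b$. For $1\le i<N$ let $E_i$ be the diagram with arcs $\{i,i+1\}$, $\{\overline i,\overline{i+1}\}$ labelled $i$ and $\{a,\overline a\}$ labelled $a$ for $a\ne i,i+1$. A *Fibonacci set* of rank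 $N$ is a set $S=\{s_1<\dots<s_k\}\subseteq\{1,\dots,N\}$ with $k\equiv N\pmod 2$ and $s_\ell\equiv\ell\pmod 2$ for all $\ell$; its *free element* is the product of the (pairwise commuting) $E_i$ over all $i\in\{1,\dots,N-1\}\setminus S$ such that $i-\max\{s\in S: s<i\}$ is odd, with $\max\emptyset=0$. A *free element* of $O_N$ is the free element of some Fibonacci set of rank $N$. Two elements $e,f\in O_N$ are $\mathcal R$-equivalent if $eO_N=fO_N$, and $\mathcal J$-equivalent if $O_NeO_N=O_NfO_N$. **Theorem.** Each $\mathcal R$-class of $O_N$ contains exactly one involutive element. Each $\mathcal J$-class of $O_N$ contains exactly one free element. Moreover, the free element in the $\mathcal J$-class of $e\in O_N$ is the free element having the same propagating set as $e$: a free element $f$ is $\mathcal J$-equivalent to $e$ if and only if $f$ and $e$ have the same propagating set. -/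

import Mathlib

/-- Vertices of a rank `N` arc-diagram are the positions `0, …, 2N-1` in the total order
`1 < 2 < ⋯ < N < N̄ < ⋯ < 2̄ < 1̄`: the position `p < N` is the left vertex `p + 1`, the position
`p ≥ N` is the right vertex `\overline{2N - p}`. This is the absolute value of the vertex. -/
def vertexAbs {N : ℕ} (p : Fin (2 * N)) : ℕ :=
  if (p : ℕ) < N then (p : ℕ) + 1 else 2 * N - (p : ℕ)

/-- Okada arc-diagrams of rank `N`: a non-crossing perfect matching of the `2N` vertices, together
with a height label for each arc (recorded at both of its endpoints). -/
@[ext]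
structure OkadaDiagram (N : ℕ) where
  /-- the other endpoint of the arc through a vertex -/
  partner : Fin (2 * N) → Fin (2 * N)
  /-- the height label of the arc through a vertex -/
  height : Fin (2 * N) → ℕ
  partner_partner : ∀ p, partner (partner p) = p
  partner_ne : ∀ p, partner p ≠ p
  height_partner : ∀ p, height (partner p) = height p
  noncrossing : ∀ a c, a < c → c < partner a → ¬ partner a < partner c
  one_le_height : ∀ p, 1 ≤ height p
  height_le : ∀ p, height p ≤ min (vertexAbs p) (vertexAbs (partner p))
  height_parity : ∀ p, height p ≡ min (vertexAbs p) (vertexAbs (partner p)) [MOD 2]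
  height_lt_of_nested : ∀ a c, c < a → a < partner a → partner a < partner c →
    height c < height a

namespace OkadaDiagram

variable {N : ℕ}

/-! ### Composition

In the concatenation of `C` (on the left) and `D` (on the right), a state `(false, p)` stands for
the vertex `p` of `C` and `(true, p)` for the vertex `p` of `D`. The right vertex `\overline{a}` of
`C` is merged with the left vertex `a` of `D`; in terms of positions, `p` is merged with
`Fin.rev p`. -/

/-- The diagram in which a state lives. -/
def pick (C D : OkadaDiagram N) : Bool → OkadaDiagram N
  | false => C
  | true => D

/-- Follow the arc of `C` or `D` that starts at a state to its other end. -/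
def across (C D : OkadaDiagram N) (x : Bool × Fin (2 * N)) : Bool × Fin (2 * N) :=
  (x.1, (pick C D x.1).partner x.2)

/-- Change the diagram at a merged vertex. -/
def swap (x : Bool × Fin (2 * N)) : Bool × Fin (2 * N) := (!x.1, x.2.rev)

/-- Follow an arc to its end, then change the diagram. -/
def trace (C D : OkadaDiagram N) (x : Bool × Fin (2 * N)) : Bool × Fin (2 * N) :=
  swap (across C D x)

/-- The height label of the arc through a state. -/
def fragHeight (C D : OkadaDiagram N) (x : Bool × Fin (2 * N)) : ℕ :=
  (pick C D x.1).height x.2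

/-- The states on the outer boundary: left vertices of `C` and right vertices of `D`. -/
def IsOuter (x : Bool × Fin (2 * N)) : Prop := x.1 = decide (N ≤ (x.2 : ℕ))

instance (x : Bool × Fin (2 * N)) : Decidable (IsOuter x) := by
  unfold IsOuter; infer_instance

/-- The state on the outer boundary that a vertex of the composition is. -/
def entry (p : Fin (2 * N)) : Bool × Fin (2 * N) := (decide (N ≤ (p : ℕ)), p)

theorem isOuter_entry (p : Fin (2 * N)) : IsOuter (entry p) := rfl

theorem isOuter_false (p : Fin (2 * N)) : IsOuter (false, p) ↔ (p : ℕ) < N := by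
  simp [IsOuter]

theorem isOuter_true (p : Fin (2 * N)) : IsOuter (true, p) ↔ N ≤ (p : ℕ) := by
  simp [IsOuter]

theorem swap_swap (x : Bool × Fin (2 * N)) : swap (swap x) = x := by
  simp [swap]

theorem across_across (C D : OkadaDiagram N) (x : Bool × Fin (2 * N)) :
    across C D (across C D x) = x := by
  simp [across, partner_partner]

theorem isOuter_swap (x : Bool × Fin (2 * N)) : IsOuter (swap x) ↔ IsOuter x := by
  obtain ⟨b, p⟩ := x
  have := p.isLt
  cases b <;> simp [IsOuter, swap, Fin.val_rev] <;> omega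

theorem trace_injective (C D : OkadaDiagram N) : Function.Injective (trace C D) := by
  intro x y h
  have h1 : across C D x = across C D y := by
    rw [← swap_swap (across C D x), ← swap_swap (across C D y)]; exact congrArg swap h
  rw [← across_across C D x, ← across_across C D y, h1]

theorem exists_return (C D : OkadaDiagram N) (p : Fin (2 * N)) :
    ∃ k, 0 < k ∧ IsOuter ((trace C D)^[k] (entry p)) := by
  obtain ⟨k, hk, h⟩ := (trace_injective C D).mem_periodicPts (entry p)
  exact ⟨k, hk, by rw [h.eq]; exact isOuter_entry p⟩

/-- The number of arcs of `C` and `D` that form the arc of the composition through `p`: the arcs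
are followed, starting at `p`, until the outer boundary is reached. -/
def compLength (C D : OkadaDiagram N) (p : Fin (2 * N)) : ℕ := Nat.find (exists_return C D p)

/-- The other end of the arc of the composition through `p`. -/
def compPartner (C D : OkadaDiagram N) (p : Fin (2 * N)) : Fin (2 * N) :=
  (across C D ((trace C D)^[compLength C D p - 1] (entry p))).2

theorem compLength_pos (C D : OkadaDiagram N) (p : Fin (2 * N)) : 0 < compLength C D p :=
  (Nat.find_spec (exists_return C D p)).1

/-- The height label of the arc of the composition through `p`: the minimum of the labels of the
arcs of `C` and `D` that form it. -/
def compHeight (C D : OkadaDiagram N) (p : Fin (2 * N)) : ℕ :=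
  (Finset.range (compLength C D p)).inf'
    (Finset.nonempty_range_iff.mpr (compLength_pos C D p).ne')
    (fun i => fragHeight C D ((trace C D)^[i] (entry p)))

/-! ### The composition is an Okada arc-diagram -/

theorem isOuter_return (C D : OkadaDiagram N) (p : Fin (2 * N)) :
    IsOuter ((trace C D)^[compLength C D p] (entry p)) :=
  (Nat.find_spec (exists_return C D p)).2

theorem not_isOuter_of_lt (C D : OkadaDiagram N) (p : Fin (2 * N)) {i : ℕ} (h0 : 0 < i)
    (hi : i < compLength C D p) : ¬ IsOuter ((trace C D)^[i] (entry p)) := fun h =>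
  Nat.find_min (exists_return C D p) hi ⟨h0, h⟩

theorem eq_entry {x : Bool × Fin (2 * N)} (h : IsOuter x) : x = entry x.2 := by
  ext1
  · exact h
  · rfl

/-- The end of the traced path is the entry state of the partner. -/
theorem across_last (C D : OkadaDiagram N) (p : Fin (2 * N)) :
    across C D ((trace C D)^[compLength C D p - 1] (entry p)) = entry (compPartner C D p) := by
  apply eq_entry
  rw [← isOuter_swap]
  have h := isOuter_return C D p
  have hk := compLength_pos C D p
  obtain ⟨k, hk'⟩ : ∃ k, compLength C D p = k + 1 := ⟨_, (Nat.succ_pred_eq_of_pos hk).symm⟩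
  rw [hk', Function.iterate_succ_apply'] at h
  rw [hk']
  exact h

theorem return_eq (C D : OkadaDiagram N) (p : Fin (2 * N)) :
    (trace C D)^[compLength C D p] (entry p) = swap (entry (compPartner C D p)) := by
  rw [← across_last]
  have hk := compLength_pos C D p
  obtain ⟨k, hk'⟩ : ∃ k, compLength C D p = k + 1 := ⟨_, (Nat.succ_pred_eq_of_pos hk).symm⟩
  rw [hk', Function.iterate_succ_apply']
  rfl

theorem trace_reverse (C D : OkadaDiagram N) (p : Fin (2 * N)) :
    ∀ i, i ≤ compLength C D p → (trace C D)^[i] (entry (compPartner C D p)) =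
      swap ((trace C D)^[compLength C D p - i] (entry p)) := by
  intro i
  induction i with
  | zero => intro _; rw [Nat.sub_zero, return_eq, swap_swap]; rfl
  | succ i ih =>
    intro hi
    rw [Function.iterate_succ_apply', ih (by omega)]
    obtain ⟨j, hj⟩ : ∃ j, compLength C D p - i = j + 1 := ⟨compLength C D p - i - 1, by omega⟩
    rw [hj, Function.iterate_succ_apply', show compLength C D p - (i + 1) = j by omega]
    simp only [trace, swap_swap, across_across]

theorem compLength_compPartner (C D : OkadaDiagram N) (p : Fin (2 * N)) :
    compLength C D (compPartner C D p) = compLength C D p := by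
  have hk := compLength_pos C D p
  conv_lhs => rw [compLength]
  rw [Nat.find_eq_iff]
  refine ⟨⟨hk, ?_⟩, ?_⟩
  · rw [trace_reverse C D p _ le_rfl, Nat.sub_self, isOuter_swap]; exact isOuter_entry p
  · rintro i hi ⟨h0, h⟩
    rw [trace_reverse C D p _ hi.le, isOuter_swap] at h
    exact not_isOuter_of_lt C D p (by omega) (by omega) h

theorem compPartner_compPartner (C D : OkadaDiagram N) (p : Fin (2 * N)) :
    compPartner C D (compPartner C D p) = p := by
  have h := return_eq C D (compPartner C D p)
  rw [compLength_compPartner, trace_reverse C D p _ le_rfl, Nat.sub_self] at h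
  have h2 := congrArg (fun x => (swap x).2) h
  simpa [swap_swap, entry] using h2.symm

theorem fragHeight_across (C D : OkadaDiagram N) (x : Bool × Fin (2 * N)) :
    fragHeight C D (across C D x) = fragHeight C D x := by
  simp [fragHeight, across, height_partner]

theorem compHeight_le (C D : OkadaDiagram N) (p : Fin (2 * N)) {i : ℕ}
    (hi : i < compLength C D p) :
    compHeight C D p ≤ fragHeight C D ((trace C D)^[i] (entry p)) :=
  Finset.inf'_le _ (Finset.mem_range.mpr hi)

theorem exists_compHeight_eq (C D : OkadaDiagram N) (p : Fin (2 * N)) :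
    ∃ i, i < compLength C D p ∧
      compHeight C D p = fragHeight C D ((trace C D)^[i] (entry p)) := by
  obtain ⟨i, hi, h⟩ := Finset.exists_mem_eq_inf'
    (Finset.nonempty_range_iff.mpr (compLength_pos C D p).ne')
    (fun i => fragHeight C D ((trace C D)^[i] (entry p)))
  exact ⟨i, Finset.mem_range.mp hi, h⟩

theorem compHeight_compPartner_le (C D : OkadaDiagram N) (p : Fin (2 * N)) :
    compHeight C D (compPartner C D p) ≤ compHeight C D p := by
  obtain ⟨i, hi, h⟩ := exists_compHeight_eq C D p
  have h2 := compHeight_le C D (compPartner C D p) (i := compLength C D p - 1 - i)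
    (by rw [compLength_compPartner]; omega)
  rw [trace_reverse C D p _ (by omega),
    show compLength C D p - (compLength C D p - 1 - i) = i + 1 by omega,
    Function.iterate_succ_apply', trace, swap_swap, fragHeight_across] at h2
  omega

theorem compHeight_compPartner (C D : OkadaDiagram N) (p : Fin (2 * N)) :
    compHeight C D (compPartner C D p) = compHeight C D p := by
  apply le_antisymm (compHeight_compPartner_le C D p)
  have := compHeight_compPartner_le C D (compPartner C D p)
  rwa [compPartner_compPartner] at this

/-- Points strictly inside an arc are matched inside that arc. -/
theorem partner_mem_between (D : OkadaDiagram N) {a c : Fin (2 * N)} (h1 : a < c)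
    (h2 : c < D.partner a) : a < D.partner c ∧ D.partner c < D.partner a := by
  have e1 := D.partner_partner a
  have e2 := D.partner_partner c
  constructor
  · by_contra h
    rcases lt_or_eq_of_le (not_lt.mp h) with h | h
    · have := D.noncrossing (D.partner c) a h (by rwa [e2])
      rw [e2] at this; exact this h2
    · rw [← h, e2] at h2; exact lt_irrefl _ h2
  · by_contra h
    rcases lt_or_eq_of_le (not_lt.mp h) with h | h
    · exact D.noncrossing a c h1 h2 h
    · rw [← e1, h, e2] at h1; exact lt_irrefl _ h1

open Classical in
/-- The number, modulo 2, of elements of `Q` before `p`. -/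
noncomputable def below (Q : Set (Fin (2 * N))) (p : Fin (2 * N)) : ZMod 2 :=
  ∑ y, if y ∈ Q ∧ y < p then 1 else 0

open Classical in
theorem sum_eq_zero_of_closed (D : OkadaDiagram N) (P : Fin (2 * N) → Prop)
    (hP : ∀ y, P y → P (D.partner y)) : (∑ y, if P y then (1 : ZMod 2) else 0) = 0 := by
  rw [← Finset.sum_filter]
  refine Finset.sum_involution (fun y _ => D.partner y) ?_ ?_ ?_ ?_
  · intro a _; exact CharTwo.add_self_eq_zero 1
  · intro a _ _; exact D.partner_ne a
  · intro a ha; simp only [Finset.mem_filter, Finset.mem_univ, true_and] at ha ⊢; exact hP a ha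
  · intro a _; exact D.partner_partner a

open Classical in
theorem below_partner_of_lt (D : OkadaDiagram N) (Q : Set (Fin (2 * N)))
    (hQ : ∀ y ∈ Q, D.partner y ∈ Q) {p : Fin (2 * N)} (hp : p < D.partner p) :
    below Q (D.partner p) = below Q p + if p ∈ Q then 1 else 0 := by
  have h := sum_eq_zero_of_closed D (fun y => y ∈ Q ∧ p < y ∧ y < D.partner p) (by
    rintro y ⟨h1, h2, h3⟩
    exact ⟨hQ y h1, partner_mem_between D h2 h3⟩)
  have h3 : (∑ y, if y = p then (if p ∈ Q then (1 : ZMod 2) else 0) else 0) =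
      if p ∈ Q then 1 else 0 := by simp
  rw [← h3, ← add_zero (below Q p + _)]
  refine Eq.trans ?_ (congrArg (fun z => below Q p +
    (∑ y, if y = p then (if p ∈ Q then (1 : ZMod 2) else 0) else 0) + z) h)
  simp only [below]
  rw [← Finset.sum_add_distrib, ← Finset.sum_add_distrib]
  refine Finset.sum_congr rfl fun y _ => ?_
  by_cases hy : y ∈ Q
  · rcases lt_trichotomy y p with h4 | h4 | h4
    · have := h4.trans hp
      simp [hy, h4, this, h4.ne, h4.not_gt]
    · subst h4; simp [hy, hp]
    · simp [hy, h4, h4.ne', h4.not_gt]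
  · have : y = p → p ∉ Q := fun e => e ▸ hy
    by_cases h5 : y = p <;> simp_all

open Classical in
theorem below_partner (D : OkadaDiagram N) (Q : Set (Fin (2 * N)))
    (hQ : ∀ y ∈ Q, D.partner y ∈ Q) (p : Fin (2 * N)) :
    below Q (D.partner p) = below Q p + if p ∈ Q then 1 else 0 := by
  rcases lt_or_gt_of_ne (D.partner_ne p) with h | h
  · have h2 := below_partner_of_lt D Q hQ (p := D.partner p) (by rwa [D.partner_partner])
    have h3 : D.partner p ∈ Q ↔ p ∈ Q :=
      ⟨fun h => D.partner_partner p ▸ hQ _ h, fun h => hQ p h⟩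
    rw [D.partner_partner] at h2
    simp only [h3] at h2
    rw [h2, add_assoc, CharTwo.add_self_eq_zero, add_zero]
  · exact below_partner_of_lt D Q hQ h

/-- If `Q` has an odd number of elements before `p`, an arc in `Q` nests the arc of `p`. -/
theorem exists_nesting (D : OkadaDiagram N) (Q : Set (Fin (2 * N)))
    (hQ : ∀ y ∈ Q, D.partner y ∈ Q) {p : Fin (2 * N)} (hp : p < D.partner p)
    (h : below Q p = 1) : ∃ y ∈ Q, D.height y < D.height p := by
  classical
  by_contra hcon
  push Not at hcon
  have h0 : below Q p = 0 := by
    rw [below]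
    convert sum_eq_zero_of_closed D (fun y => y ∈ Q ∧ y < p) ?_
    rintro y ⟨h1, h2⟩
    refine ⟨hQ y h1, ?_⟩
    by_contra h3
    rcases lt_or_eq_of_le (not_lt.mp h3) with h3 | h3
    · have h4 := (partner_mem_between D h2 h3).2
      exact absurd (D.height_lt_of_nested p y h2 hp h4) (not_lt.mpr (hcon y h1))
    · have h5 : D.partner p = y := by rw [h3, D.partner_partner]
      rw [h5] at hp; exact lt_asymm hp h2
  rw [h0] at h
  exact absurd h (by decide)

theorem below_univ (p : Fin (2 * N)) : below Set.univ p = ((p : ℕ) : ZMod 2) := by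
  classical
  rw [below]
  simp only [Set.mem_univ, true_and]
  rw [← Finset.sum_filter, Finset.sum_const, nsmul_eq_mul, mul_one]
  congr 1
  have : (Finset.univ.filter fun y => y < p) = Finset.Iio p := by ext; simp
  rw [this, Fin.card_Iio]

theorem cast_partner (D : OkadaDiagram N) (p : Fin (2 * N)) :
    ((D.partner p : ℕ) : ZMod 2) = (p : ℕ) + 1 := by
  have := below_partner D Set.univ (fun _ _ => Set.mem_univ _) p
  simpa [below_univ] using this

theorem min_abs_parity {p q : Fin (2 * N)} (h : ((q : ℕ) : ZMod 2) = (p : ℕ) + 1)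
    (hlt : p < q) : min (vertexAbs p) (vertexAbs q) ≡ (p : ℕ) + 1 [MOD 2] := by
  have h' : (q : ℕ) ≡ (p : ℕ) + 1 [MOD 2] := by
    rw [← ZMod.natCast_eq_natCast_iff]; push_cast; exact h
  unfold Nat.ModEq at *
  have := p.isLt
  have := q.isLt
  have : (p : ℕ) < q := hlt
  unfold vertexAbs
  split_ifs <;> omega

/-- A set of states is saturated if it is a union of connected components. -/
structure Saturated (C D : OkadaDiagram N) (Q : Set (Bool × Fin (2 * N))) : Prop where
  across_mem : ∀ x ∈ Q, across C D x ∈ Q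
  swap_mem : ∀ x ∈ Q, ¬ IsOuter x → swap x ∈ Q

/-- The part of a set of states that lies in one of the two diagrams. -/
def slice (Q : Set (Bool × Fin (2 * N))) (b : Bool) : Set (Fin (2 * N)) := {y | (b, y) ∈ Q}

theorem Saturated.slice_closed {C D : OkadaDiagram N} {Q : Set (Bool × Fin (2 * N))}
    (hQ : Saturated C D Q) (b : Bool) :
    ∀ y ∈ slice Q b, (pick C D b).partner y ∈ slice Q b := fun y hy =>
  hQ.across_mem (b, y) hy

theorem Saturated.across_iff {C D : OkadaDiagram N} {Q : Set (Bool × Fin (2 * N))}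
    (hQ : Saturated C D Q) (x : Bool × Fin (2 * N)) : across C D x ∈ Q ↔ x ∈ Q :=
  ⟨fun h => across_across C D x ▸ hQ.across_mem _ h, hQ.across_mem x⟩

theorem Saturated.swap_iff {C D : OkadaDiagram N} {Q : Set (Bool × Fin (2 * N))}
    (hQ : Saturated C D Q) {x : Bool × Fin (2 * N)} (hx : ¬ IsOuter x) : swap x ∈ Q ↔ x ∈ Q :=
  ⟨fun h => swap_swap x ▸ hQ.swap_mem _ h (by rwa [isOuter_swap]), fun h => hQ.swap_mem x h hx⟩

/-- The parity of the number of elements of `Q` before a state, in its own diagram. -/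
noncomputable def depth (Q : Set (Bool × Fin (2 * N))) (x : Bool × Fin (2 * N)) : ZMod 2 :=
  below (slice Q x.1) x.2

open Classical in
theorem Saturated.depth_across {C D : OkadaDiagram N} {Q : Set (Bool × Fin (2 * N))}
    (hQ : Saturated C D Q) (x : Bool × Fin (2 * N)) :
    depth Q (across C D x) = depth Q x + if x ∈ Q then 1 else 0 :=
  below_partner (pick C D x.1) (slice Q x.1) (hQ.slice_closed x.1) x.2

open Classical in
theorem Saturated.depth_swap_aux {C D : OkadaDiagram N} {Q : Set (Bool × Fin (2 * N))}
    (hQ : Saturated C D Q) (p : Fin (2 * N)) (hp : N ≤ (p : ℕ)) :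
    depth Q (true, p.rev) = depth Q (false, p) + if (false, p) ∈ Q then 1 else 0 := by
  have h := sum_eq_zero_of_closed C (fun y => (false, y) ∈ Q) (hQ.slice_closed false)
  have h3 : (∑ y, if y = p then (if (false, p) ∈ Q then (1 : ZMod 2) else 0) else 0) =
      if (false, p) ∈ Q then 1 else 0 := by simp
  have e : ∀ a b : ZMod 2, a + b = 0 → a = b := by decide
  apply e
  rw [← h3]
  refine Eq.trans ?_ h
  simp only [depth, below]
  rw [← Equiv.sum_comp Fin.revPerm, ← Finset.sum_add_distrib, ← Finset.sum_add_distrib]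
  refine Finset.sum_congr rfl fun y _ => ?_
  simp only [slice, Set.mem_ofPred_eq, Fin.revPerm_apply, Fin.rev_lt_rev]
  rcases lt_trichotomy y p with h4 | h4 | h4
  · simp [h4, h4.ne, h4.not_gt]
  · subst h4; simp
  · have hy : ¬ IsOuter (false, y) := by
      have : (p : ℕ) < y := h4
      simp [IsOuter]; omega
    have := hQ.swap_iff hy
    simp only [swap, Bool.not_false] at this
    simp [h4, h4.ne', h4.not_gt, this]

open Classical in
theorem Saturated.depth_swap {C D : OkadaDiagram N} {Q : Set (Bool × Fin (2 * N))}
    (hQ : Saturated C D Q) {x : Bool × Fin (2 * N)} (hx : ¬ IsOuter x) :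
    depth Q (swap x) = depth Q x + if x ∈ Q then 1 else 0 := by
  obtain ⟨b, p⟩ := x
  cases b with
  | false =>
    exact hQ.depth_swap_aux p (by simpa [IsOuter] using hx)
  | true =>
    have hp : (p : ℕ) < N := by simpa [IsOuter] using hx
    have h := hQ.depth_swap_aux p.rev (by rw [Fin.val_rev]; omega)
    have h2 := hQ.swap_iff hx
    simp only [swap, Bool.not_true] at h2 ⊢
    rw [Fin.rev_rev] at h
    simp only [h2] at h
    rw [h, add_assoc, CharTwo.add_self_eq_zero, add_zero]

open Classical in
theorem Saturated.depth_trace {C D : OkadaDiagram N} {Q : Set (Bool × Fin (2 * N))}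
    (hQ : Saturated C D Q) {x : Bool × Fin (2 * N)} (hx : ¬ IsOuter (trace C D x)) :
    depth Q (trace C D x) = depth Q x := by
  rw [trace, isOuter_swap] at hx
  rw [trace, hQ.depth_swap hx, hQ.depth_across]
  simp only [hQ.across_iff]
  rw [add_assoc, CharTwo.add_self_eq_zero, add_zero]

theorem Saturated.depth_iterate {C D : OkadaDiagram N} {Q : Set (Bool × Fin (2 * N))}
    (hQ : Saturated C D Q) (p : Fin (2 * N)) : ∀ i, i < compLength C D p →
    depth Q ((trace C D)^[i] (entry p)) = depth Q (entry p) := by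
  intro i
  induction i with
  | zero => intro _; rfl
  | succ i ih =>
    intro hi
    rw [← ih (by omega), Function.iterate_succ_apply']
    apply hQ.depth_trace
    rw [← Function.iterate_succ_apply' (trace C D)]
    exact not_isOuter_of_lt C D p (by omega) hi

theorem Saturated.mem_iterate {C D : OkadaDiagram N} {Q : Set (Bool × Fin (2 * N))}
    (hQ : Saturated C D Q) (p : Fin (2 * N)) : ∀ i, i < compLength C D p →
    ((trace C D)^[i] (entry p) ∈ Q ↔ entry p ∈ Q) := by
  intro i
  induction i with
  | zero => intro _; rfl
  | succ i ih =>
    intro hi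
    have h := not_isOuter_of_lt C D p (by omega) hi
    rw [← ih (by omega)]
    rw [Function.iterate_succ_apply', trace] at h ⊢
    rw [isOuter_swap] at h
    rw [hQ.swap_iff h, hQ.across_iff]

open Classical in
theorem Saturated.depth_compPartner {C D : OkadaDiagram N} {Q : Set (Bool × Fin (2 * N))}
    (hQ : Saturated C D Q) (p : Fin (2 * N)) :
    depth Q (entry (compPartner C D p)) = depth Q (entry p) + if entry p ∈ Q then 1 else 0 := by
  have hk := compLength_pos C D p
  rw [← across_last, hQ.depth_across, hQ.depth_iterate p _ (by omega)]
  simp only [hQ.mem_iterate p _ (show compLength C D p - 1 < compLength C D p by omega)]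

/-- On the outer boundary, the depth is computed in the order of the composition. -/
theorem Saturated.depth_entry {C D : OkadaDiagram N} {Q : Set (Bool × Fin (2 * N))}
    (hQ : Saturated C D Q) (p : Fin (2 * N)) :
    depth Q (entry p) = below {y | entry y ∈ Q} p := by
  classical
  have e : ∀ a b : ZMod 2, a + b = 0 → a = b := by decide
  simp only [depth, below, entry, slice, Set.mem_ofPred_eq]
  by_cases hp : N ≤ (p : ℕ)
  · simp only [hp, decide_true]
    have h := sum_eq_zero_of_closed C (fun y => (false, y) ∈ Q) (hQ.slice_closed false)
    apply e
    have h2 : (∑ y : Fin (2 * N), if (true, y) ∈ Q ∧ (y : ℕ) < N then (1 : ZMod 2) else 0) =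
        ∑ y : Fin (2 * N), if (false, y) ∈ Q ∧ N ≤ (y : ℕ) then (1 : ZMod 2) else 0 := by
      rw [← Equiv.sum_comp Fin.revPerm]
      refine Finset.sum_congr rfl fun y _ => ?_
      simp only [Fin.revPerm_apply]
      by_cases hy : N ≤ (y : ℕ)
      · have hy' : ¬ IsOuter (false, y) := by simp [IsOuter]; omega
        have h3 := hQ.swap_iff hy'
        simp only [swap, Bool.not_false] at h3
        have : (y.rev : ℕ) < N := by rw [Fin.val_rev]; omega
        simp only [h3, hy, this]
      · have : ¬ (y.rev : ℕ) < N := by rw [Fin.val_rev]; omega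
        simp only [hy, this, and_false]
    have h4 : (∑ y : Fin (2 * N), if (true, y) ∈ Q ∧ (y : ℕ) < N then (1 : ZMod 2) else 0) +
        (∑ y : Fin (2 * N), if (false, y) ∈ Q ∧ (y : ℕ) < N then (1 : ZMod 2) else 0) = 0 := by
      rw [h2, ← Finset.sum_add_distrib]
      refine Eq.trans ?_ h
      refine Finset.sum_congr rfl fun y _ => ?_
      by_cases hy : N ≤ (y : ℕ)
      · simp [hy, not_lt.mpr hy]
      · simp [hy, not_le.mp hy]
    refine Eq.trans ?_ h4
    rw [← Finset.sum_add_distrib, ← Finset.sum_add_distrib]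
    refine Finset.sum_congr rfl fun y _ => ?_
    by_cases hy : N ≤ (y : ℕ)
    · have hN : ¬ (y : ℕ) < N := not_lt.mpr hy
      simp only [hy, decide_true, hN, and_false, if_false, add_zero]
      exact CharTwo.add_self_eq_zero _
    · have hyp : y < p := by
        rw [Fin.lt_def]; omega
      simp [hy, hyp, not_le.mp hy]
  · simp only [hp, decide_false]
    refine Finset.sum_congr rfl fun y _ => ?_
    by_cases hy : y < p
    · have : ¬ N ≤ (y : ℕ) := by
        have : (y : ℕ) < p := hy
        omega
      simp [this]
    · simp [hy]

/-- The states on the path through a vertex of the composition. -/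
def pathSet (C D : OkadaDiagram N) (p : Fin (2 * N)) : Set (Bool × Fin (2 * N)) :=
  {x | ∃ i, i < compLength C D p ∧
    (x = (trace C D)^[i] (entry p) ∨ x = across C D ((trace C D)^[i] (entry p)))}

theorem saturated_pathSet (C D : OkadaDiagram N) (p : Fin (2 * N)) :
    Saturated C D (pathSet C D p) := by
  constructor
  · rintro x ⟨i, hi, rfl | rfl⟩
    · exact ⟨i, hi, Or.inr rfl⟩
    · exact ⟨i, hi, Or.inl (across_across C D _)⟩
  · rintro x ⟨i, hi, rfl | rfl⟩ hx
    · cases i with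
      | zero => exact absurd (isOuter_entry p) hx
      | succ i =>
        refine ⟨i, by omega, Or.inr ?_⟩
        rw [Function.iterate_succ_apply', trace, swap_swap]
    · rw [← isOuter_swap] at hx
      change ¬ IsOuter (trace C D _) at hx
      rw [← Function.iterate_succ_apply' (trace C D)] at hx
      refine ⟨i + 1, ?_, Or.inl ?_⟩
      · by_contra h
        have : i + 1 = compLength C D p := by omega
        rw [Nat.succ_eq_add_one, this] at hx
        exact hx (isOuter_return C D p)
      · rw [Function.iterate_succ_apply']; rfl

theorem entry_mem_pathSet (C D : OkadaDiagram N) (p y : Fin (2 * N)) :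
    entry y ∈ pathSet C D p ↔ y = p ∨ y = compPartner C D p := by
  constructor
  · rintro ⟨i, hi, h | h⟩
    · left
      cases i with
      | zero => exact congrArg Prod.snd h
      | succ i =>
        exact absurd (h ▸ isOuter_entry y) (not_isOuter_of_lt C D p (Nat.succ_pos i) hi)
    · right
      by_cases hk : i + 1 = compLength C D p
      · have hi' : i = compLength C D p - 1 := by omega
        rw [hi', across_last] at h
        exact congrArg Prod.snd h
      · have h2 := not_isOuter_of_lt C D p (i := i + 1) (by omega) (by omega)
        rw [Function.iterate_succ_apply', trace, isOuter_swap, ← h] at h2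
        exact absurd (isOuter_entry y) h2
  · have hk := compLength_pos C D p
    rintro (rfl | rfl)
    · exact ⟨0, hk, Or.inl rfl⟩
    · exact ⟨_, Nat.sub_lt hk one_pos, Or.inr (across_last C D p).symm⟩

theorem compHeight_le_of_mem (C D : OkadaDiagram N) (p : Fin (2 * N))
    {x : Bool × Fin (2 * N)} (hx : x ∈ pathSet C D p) :
    compHeight C D p ≤ fragHeight C D x := by
  obtain ⟨i, hi, rfl | rfl⟩ := hx
  · exact compHeight_le C D p hi
  · rw [fragHeight_across]; exact compHeight_le C D p hi

theorem cast_trace (C D : OkadaDiagram N) (x : Bool × Fin (2 * N)) :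
    (((trace C D x).2 : ℕ) : ZMod 2) = ((x.2 : ℕ) : ZMod 2) := by
  have h := cast_partner (pick C D x.1) x.2
  simp only [trace, swap, across]
  set q := (pick C D x.1).partner x.2
  have h2 : ((q.rev : ℕ) : ZMod 2) + (q : ℕ) + 1 = 0 := by
    have : (q.rev : ℕ) + q + 1 = 2 * N := by rw [Fin.val_rev]; omega
    rw [← Nat.cast_add, ← Nat.cast_succ, Nat.succ_eq_add_one, this, Nat.cast_mul]
    have : ((2 : ℕ) : ZMod 2) = 0 := rfl
    rw [this, zero_mul]
  rw [h] at h2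
  have e : ∀ a b : ZMod 2, a + (b + 1) + 1 = 0 → a = b := by decide
  exact e _ _ h2

theorem cast_iterate (C D : OkadaDiagram N) (x : Bool × Fin (2 * N)) (i : ℕ) :
    ((((trace C D)^[i] x).2 : ℕ) : ZMod 2) = ((x.2 : ℕ) : ZMod 2) := by
  induction i with
  | zero => rfl
  | succ i ih => rw [Function.iterate_succ_apply', cast_trace, ih]

theorem cast_compPartner (C D : OkadaDiagram N) (p : Fin (2 * N)) :
    ((compPartner C D p : ℕ) : ZMod 2) = (p : ℕ) + 1 := by
  rw [compPartner]
  simp only [across]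
  rw [cast_partner, cast_iterate]
  rfl

theorem compPartner_ne (C D : OkadaDiagram N) (p : Fin (2 * N)) : compPartner C D p ≠ p := by
  intro h
  have := cast_compPartner C D p
  rw [h] at this
  have e : ∀ a : ZMod 2, a ≠ a + 1 := by decide
  exact e _ this

open Classical in
theorem below_pathSet (C D : OkadaDiagram N) (p q : Fin (2 * N)) :
    depth (pathSet C D p) (entry q) =
      (if p < q then 1 else 0) + (if compPartner C D p < q then 1 else 0) := by
  rw [(saturated_pathSet C D p).depth_entry, below]
  simp only [Set.mem_ofPred_eq, entry_mem_pathSet]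
  have hne := compPartner_ne C D p
  have h1 : (∑ y, if y = p then (if p < q then (1 : ZMod 2) else 0) else 0) =
      if p < q then 1 else 0 := by simp
  have h2 : (∑ y, if y = compPartner C D p then
      (if compPartner C D p < q then (1 : ZMod 2) else 0) else 0) =
      if compPartner C D p < q then 1 else 0 := by simp
  rw [← h1, ← h2, ← Finset.sum_add_distrib]
  refine Finset.sum_congr rfl fun y _ => ?_
  by_cases h3 : y = p
  · subst h3; simp [hne.symm]
  · by_cases h4 : y = compPartner C D p
    · subst h4; simp [hne]
    · simp [h3, h4]

theorem comp_noncrossing (C D : OkadaDiagram N) (a c : Fin (2 * N)) (h1 : a < c)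
    (h2 : c < compPartner C D a) : ¬ compPartner C D a < compPartner C D c := by
  classical
  intro h3
  have h := (saturated_pathSet C D a).depth_compPartner c
  have hc : entry c ∉ pathSet C D a := by
    rw [entry_mem_pathSet]; rintro (h | h)
    · exact h1.ne' h
    · exact h2.ne h
  rw [below_pathSet, below_pathSet, if_neg hc, if_pos h1, if_neg h2.not_gt, if_pos h3,
    if_pos ((h1.trans h2).trans h3)] at h
  exact absurd h (by decide)

/-- Every arc of a path that is enclosed by a saturated set is nested in an arc of that set. -/
theorem Saturated.exists_lower {C D : OkadaDiagram N} {Q : Set (Bool × Fin (2 * N))}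
    (hQ : Saturated C D Q) {x : Bool × Fin (2 * N)} (hx : x.2 < (across C D x).2)
    (h : depth Q x = 1) : ∃ y ∈ Q, fragHeight C D y < fragHeight C D x := by
  obtain ⟨y, hy, h⟩ := exists_nesting (pick C D x.1) (slice Q x.1) (hQ.slice_closed x.1) hx h
  exact ⟨(x.1, y), hy, h⟩

theorem comp_nested (C D : OkadaDiagram N) (a c : Fin (2 * N)) (h1 : c < a)
    (h2 : a < compPartner C D a) (h3 : compPartner C D a < compPartner C D c) :
    compHeight C D c < compHeight C D a := by
  classical
  obtain ⟨i, hi, he⟩ := exists_compHeight_eq C D a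
  have hQ := saturated_pathSet C D c
  have ha : entry a ∉ pathSet C D c := by
    rw [entry_mem_pathSet]; rintro (h | h)
    · exact h1.ne' h
    · exact (h2.trans h3).ne h
  have hd := hQ.depth_iterate a i hi
  have hm := hQ.mem_iterate a i hi
  rw [below_pathSet, if_pos h1, if_neg (h2.trans h3).not_gt, add_zero] at hd
  rw [he]
  set x := (trace C D)^[i] (entry a)
  have hx : x ∉ pathSet C D c := fun h => ha (hm.mp h)
  obtain ⟨y, hy, hlt⟩ : ∃ y ∈ pathSet C D c, fragHeight C D y < fragHeight C D x := by
    rcases lt_or_gt_of_ne ((pick C D x.1).partner_ne x.2) with h | h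
    · rw [← fragHeight_across]
      refine hQ.exists_lower ?_ ?_
      · rw [across_across]; exact h
      · rw [hQ.depth_across, hd, if_neg hx, add_zero]
    · exact hQ.exists_lower h hd
  exact lt_of_le_of_lt (compHeight_le_of_mem C D c hy) hlt

theorem comp_parity_of_lt (C D : OkadaDiagram N) (p : Fin (2 * N)) (hp : p < compPartner C D p) :
    compHeight C D p ≡ min (vertexAbs p) (vertexAbs (compPartner C D p)) [MOD 2] := by
  classical
  refine Nat.ModEq.trans ?_ (min_abs_parity (cast_compPartner C D p) hp).symm
  obtain ⟨i, hi, he⟩ := exists_compHeight_eq C D p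
  have hQ := saturated_pathSet C D p
  have hd := hQ.depth_iterate p i hi
  have hc := cast_iterate C D (entry p) i
  rw [below_pathSet, if_neg (lt_irrefl p), if_neg hp.not_gt, add_zero] at hd
  have hx : (trace C D)^[i] (entry p) ∈ pathSet C D p := ⟨i, hi, Or.inl rfl⟩
  set x := (trace C D)^[i] (entry p)
  have hlow : x.2 < (across C D x).2 := by
    rcases lt_or_gt_of_ne ((pick C D x.1).partner_ne x.2) with h | h
    · exfalso
      obtain ⟨y, hy, hlt⟩ := hQ.exists_lower (x := across C D x)
        (by rw [across_across]; exact h) (by rw [hQ.depth_across, hd, if_pos hx, zero_add])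
      rw [fragHeight_across, ← he] at hlt
      exact absurd (compHeight_le_of_mem C D p hy) (not_le.mpr hlt)
    · exact h
  rw [he]
  refine ((pick C D x.1).height_parity x.2).trans ?_
  refine (min_abs_parity (cast_partner (pick C D x.1) x.2) hlow).trans ?_
  have : (x.2 : ℕ) ≡ (p : ℕ) [MOD 2] := by
    rw [← ZMod.natCast_eq_natCast_iff]; exact hc
  exact this.add_right 1

theorem comp_parity (C D : OkadaDiagram N) (p : Fin (2 * N)) :
    compHeight C D p ≡ min (vertexAbs p) (vertexAbs (compPartner C D p)) [MOD 2] := by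
  rcases lt_or_gt_of_ne (compPartner_ne C D p) with h | h
  · have := comp_parity_of_lt C D (compPartner C D p) (by rwa [compPartner_compPartner])
    rwa [compPartner_compPartner, compHeight_compPartner, min_comm] at this
  · exact comp_parity_of_lt C D p h

theorem comp_height_le (C D : OkadaDiagram N) (p : Fin (2 * N)) :
    compHeight C D p ≤ vertexAbs p :=
  (compHeight_le C D p (compLength_pos C D p)).trans
    (((pick C D _).height_le _).trans (min_le_left _ _))

/-- The composition of Okada arc-diagrams, with its loops removed. -/
instance : Mul (OkadaDiagram N) where
  mul C D :=
    { partner := compPartner C D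
      height := compHeight C D
      partner_partner := compPartner_compPartner C D
      partner_ne := compPartner_ne C D
      height_partner := compHeight_compPartner C D
      noncrossing := comp_noncrossing C D
      one_le_height := fun p => by
        obtain ⟨i, _, h⟩ := exists_compHeight_eq C D p
        rw [h]; exact (pick C D _).one_le_height _
      height_le := fun p => le_min (comp_height_le C D p) (by
        rw [← compHeight_compPartner]; exact comp_height_le C D _)
      height_parity := comp_parity C D
      height_lt_of_nested := comp_nested C D }

/-- The identity diagram: the arcs `a - \overline{a}` with label `a`. -/
instance : One (OkadaDiagram N) where
  one :=
    { partner := Fin.rev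
      height := vertexAbs
      partner_partner := Fin.rev_rev
      partner_ne := fun p h => by
        have := congrArg Fin.val h
        rw [Fin.val_rev] at this; omega
      height_partner := fun p => by
        have := p.isLt
        unfold vertexAbs
        rw [Fin.val_rev]; split_ifs <;> omega
      noncrossing := fun a c h1 h2 h3 => by
        simp only [Fin.lt_def, Fin.val_rev] at *; omega
      one_le_height := fun p => by
        have := p.isLt
        unfold vertexAbs; split_ifs <;> omega
      height_le := fun p => by
        have := p.isLt
        unfold vertexAbs
        rw [Fin.val_rev]; split_ifs <;> omega
      height_parity := fun p => by
        have := p.isLt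
        unfold vertexAbs Nat.ModEq
        rw [Fin.val_rev]; split_ifs <;> omega
      height_lt_of_nested := fun a c h1 h2 h3 => by
        simp only [Fin.lt_def, Fin.val_rev, vertexAbs] at *
        split_ifs <;> omega }

theorem mul_partner (C D : OkadaDiagram N) (p : Fin (2 * N)) :
    (C * D).partner p = compPartner C D p := rfl

theorem mul_height (C D : OkadaDiagram N) (p : Fin (2 * N)) :
    (C * D).height p = compHeight C D p := rfl

theorem one_partner (p : Fin (2 * N)) : (1 : OkadaDiagram N).partner p = p.rev := rfl

theorem one_height (p : Fin (2 * N)) : (1 : OkadaDiagram N).height p = vertexAbs p := rfl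

/-! ### The monoid laws -/

/-- `Ret f O h x y m`: the first state in `O` after `x` under the iteration of `f` is `y`, and `m`
is the minimum of `h` on the states before `y`. -/
inductive Ret {X : Type*} (f : X → X) (O : X → Prop) (h : X → ℕ) : X → X → ℕ → Prop
  | last (x : X) (hx : O (f x)) : Ret f O h x (f x) (h x)
  | step (x y : X) (m : ℕ) (hx : ¬ O (f x)) (hr : Ret f O h (f x) y m) :
      Ret f O h x y (min (h x) m)

theorem Ret.unique {X : Type*} {f : X → X} {O : X → Prop} {h : X → ℕ} {x y y' : X} {m m' : ℕ}
    (h1 : Ret f O h x y m) (h2 : Ret f O h x y' m') : y = y' ∧ m = m' := by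
  induction h1 generalizing m' with
  | last x hx =>
    cases h2 with
    | last => exact ⟨rfl, rfl⟩
    | step _ _ _ hn => exact absurd hx hn
  | step x y m hx hr ih =>
    cases h2 with
    | last _ hn => exact absurd hn hx
    | step _ _ m2 _ hr2 =>
      obtain ⟨e1, e2⟩ := ih hr2
      exact ⟨e1, by rw [e2]⟩

theorem Ret.append {X : Type*} {f : X → X} {O O' : X → Prop} {h : X → ℕ}
    (hO : ∀ x, O x → O' x) {x z y : X} {m m' : ℕ} (h1 : Ret f O' h x z m) (hz : ¬ O z)
    (h2 : Ret f O h z y m') : Ret f O h x y (min m m') := by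
  induction h1 with
  | last x hx => exact Ret.step x y m' hz h2
  | step x z m hx hr ih =>
    rw [min_assoc]
    exact Ret.step x y _ (fun hn => hx (hO _ hn)) (ih hz h2)

theorem Ret.mono {X : Type*} {f : X → X} {O O' : X → Prop} {h : X → ℕ}
    (hO : ∀ x, O x → O' x) {x z : X} {m : ℕ} (h1 : Ret f O' h x z m) (hz : O z) :
    Ret f O h x z m := by
  induction h1 with
  | last x hx => exact Ret.last x hz
  | step x z m hx hr ih => exact Ret.step x z m (fun hn => hx (hO _ hn)) (ih hz)

theorem Ret.blocks {X Y : Type*} {f : X → X} {g : Y → Y} {O O' : X → Prop} {P : Y → Prop}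
    {h : X → ℕ} {k : Y → ℕ} (φ : Y → X) (hO : ∀ x, O x → O' x) (hP : ∀ y, O (φ y) ↔ P y)
    (hb : ∀ y, Ret f O' h (φ y) (φ (g y)) (k y)) {x y : Y} {m : ℕ} (h1 : Ret g P k x y m) :
    Ret f O h (φ x) (φ y) m := by
  induction h1 with
  | last x hx => exact (hb x).mono hO ((hP _).mpr hx)
  | step x y m hx hr ih => exact (hb x).append hO (fun hn => hx ((hP _).mp hn)) ih

theorem ret_of_iterate {X : Type*} (f : X → X) (O : X → Prop) (h : X → ℕ) (k : ℕ) :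
    ∀ x, O (f^[k + 1] x) → (∀ i, 0 < i → i < k + 1 → ¬ O (f^[i] x)) →
      Ret f O h x (f^[k + 1] x)
        ((Finset.range (k + 1)).inf' Finset.nonempty_range_add_one (fun i => h (f^[i] x))) := by
  induction k with
  | zero => intro x h1 _; exact Ret.last x h1
  | succ k ih =>
    intro x h1 h2
    have h3 := ih (f x) h1 (fun i hi hk => h2 (i + 1) (by omega) (by omega))
    have h4 := Ret.step x _ _ (h2 1 one_pos (by omega)) h3
    refine Eq.subst (motive := fun z => Ret f O h x (f^[k + 1 + 1] x) z) ?_ h4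
    symm
    apply le_antisymm
    · refine le_min (Finset.inf'_le (fun i => h (f^[i] x)) (b := 0) (by simp)) ?_
      refine Finset.le_inf' _ _ fun i hi => ?_
      exact Finset.inf'_le (fun i => h (f^[i] x)) (b := i + 1) (by simp at hi ⊢; omega)
    · refine Finset.le_inf' _ _ fun i hi => ?_
      cases i with
      | zero => exact min_le_left _ _
      | succ i =>
        refine (min_le_right _ _).trans ?_
        exact Finset.inf'_le (fun i => h (f^[i] (f x))) (b := i) (by simp at hi ⊢; omega)

theorem ret_comp (C D : OkadaDiagram N) (p : Fin (2 * N)) :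
    Ret (trace C D) IsOuter (fragHeight C D) (entry p) (swap (entry ((C * D).partner p)))
      ((C * D).height p) := by
  have aux : ∀ k (hk : (Finset.range k).Nonempty), IsOuter ((trace C D)^[k] (entry p)) →
      (∀ i, 0 < i → i < k → ¬ IsOuter ((trace C D)^[i] (entry p))) →
      Ret (trace C D) IsOuter (fragHeight C D) (entry p) ((trace C D)^[k] (entry p))
        ((Finset.range k).inf' hk (fun i => fragHeight C D ((trace C D)^[i] (entry p)))) := by
    intro k hk h1 h2
    cases k with
    | zero => simp at hk
    | succ k => exact ret_of_iterate _ _ _ k _ h1 h2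
  rw [mul_partner, mul_height, ← return_eq]
  exact aux _ _ (isOuter_return C D p) (fun i h0 hi => not_isOuter_of_lt C D p h0 hi)

theorem eq_of_ret (C D E : OkadaDiagram N)
    (h : ∀ p, Ret (trace C D) IsOuter (fragHeight C D) (entry p) (swap (entry (E.partner p)))
      (E.height p)) : C * D = E := by
  ext p
  · have := congrArg (fun x => (swap x).2) ((ret_comp C D p).unique (h p)).1
    simp only [swap_swap] at this
    exact congrArg Fin.val this
  · exact ((ret_comp C D p).unique (h p)).2

/-- The three diagrams of a triple composition. -/
def pick3 (C D E : OkadaDiagram N) (s : Fin 3) : OkadaDiagram N :=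
  if s = 0 then C else if s = 1 then D else E

/-- Tracing of arcs in the concatenation of three diagrams. -/
def trace3 (C D E : OkadaDiagram N) (x : Fin 3 × Fin (2 * N)) : Fin 3 × Fin (2 * N) :=
  (if ((pick3 C D E x.1).partner x.2 : ℕ) < N then x.1 - 1 else x.1 + 1,
    ((pick3 C D E x.1).partner x.2).rev)

theorem trace3_of_lt (C D E : OkadaDiagram N) (s : Fin 3) (p : Fin (2 * N))
    (h : ((pick3 C D E s).partner p : ℕ) < N) :
    trace3 C D E (s, p) = (s - 1, ((pick3 C D E s).partner p).rev) := by
  simp only [trace3, if_pos h]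

theorem trace3_of_le (C D E : OkadaDiagram N) (s : Fin 3) (p : Fin (2 * N))
    (h : N ≤ ((pick3 C D E s).partner p : ℕ)) :
    trace3 C D E (s, p) = (s + 1, ((pick3 C D E s).partner p).rev) := by
  simp only [trace3, if_neg (not_lt.mpr h)]

/-- The outer boundary of the concatenation of three diagrams. -/
def IsOuter3 (x : Fin 3 × Fin (2 * N)) : Prop :=
  (x.1 = 0 ∧ (x.2 : ℕ) < N) ∨ (x.1 = 2 ∧ N ≤ (x.2 : ℕ))

/-- The height label of the arc through a state, for three diagrams. -/
def fragHeight3 (C D E : OkadaDiagram N) (x : Fin 3 × Fin (2 * N)) : ℕ :=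
  (pick3 C D E x.1).height x.2

/-- The boundary when the first two diagrams are considered as one. -/
def BdL (x : Fin 3 × Fin (2 * N)) : Prop :=
  x.1 = 2 ∨ (x.1 = 0 ∧ (x.2 : ℕ) < N) ∨ (x.1 = 1 ∧ N ≤ (x.2 : ℕ))

/-- The boundary when the last two diagrams are considered as one. -/
def BdR (x : Fin 3 × Fin (2 * N)) : Prop :=
  x.1 = 0 ∨ (x.1 = 1 ∧ (x.2 : ℕ) < N) ∨ (x.1 = 2 ∧ N ≤ (x.2 : ℕ))

/-- The states of `(C * D) * E` in the triple concatenation. -/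
def embL (x : Bool × Fin (2 * N)) : Fin 3 × Fin (2 * N) :=
  (if x.1 then 2 else if (x.2 : ℕ) < N then 0 else 1, x.2)

/-- The states of `C * (D * E)` in the triple concatenation. -/
def embR (x : Bool × Fin (2 * N)) : Fin 3 × Fin (2 * N) :=
  (if x.1 then (if (x.2 : ℕ) < N then 1 else 2) else 0, x.2)

theorem ret_left (C D E : OkadaDiagram N) {x y : Bool × Fin (2 * N)} {m : ℕ}
    (h : Ret (trace C D) IsOuter (fragHeight C D) x y m) :
    Ret (trace3 C D E) BdL (fragHeight3 C D E) (if x.1 then 1 else 0, x.2) (2, y.2) m := by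
  induction h with
  | last x hx =>
    obtain ⟨b, p⟩ := x
    have hq : trace3 C D E (if b then 1 else 0, p) = (2, (trace C D (b, p)).2) := by
      rw [trace, isOuter_swap] at hx
      cases b
      · exact trace3_of_lt C D E 0 p ((isOuter_false _).mp hx)
      · exact trace3_of_le C D E 1 p ((isOuter_true _).mp hx)
    have h2 := Ret.last (f := trace3 C D E) (O := BdL) (h := fragHeight3 C D E)
      (if b then 1 else 0, p) (by rw [hq]; exact Or.inl rfl)
    rw [hq] at h2
    cases b <;> exact h2
  | step x y m hx hr ih =>
    obtain ⟨b, p⟩ := x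
    have hq : trace3 C D E (if b then 1 else 0, p) =
        (if (trace C D (b, p)).1 then 1 else 0, (trace C D (b, p)).2) := by
      rw [trace, isOuter_swap] at hx
      cases b
      · exact trace3_of_le C D E 0 p (not_lt.mp (mt (isOuter_false _).mpr hx))
      · exact trace3_of_lt C D E 1 p (not_le.mp (mt (isOuter_true _).mpr hx))
    rw [← hq] at ih
    have h2 := Ret.step _ _ _ (by
      rw [hq]
      generalize trace C D (b, p) = z at hx
      obtain ⟨c, q⟩ := z
      cases c <;> simp [IsOuter, BdL] at hx ⊢ <;> exact hx) ih
    cases b <;> exact h2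

theorem ret_right (C D E : OkadaDiagram N) {x y : Bool × Fin (2 * N)} {m : ℕ}
    (h : Ret (trace D E) IsOuter (fragHeight D E) x y m) :
    Ret (trace3 C D E) BdR (fragHeight3 C D E) (if x.1 then 2 else 1, x.2) (0, y.2) m := by
  induction h with
  | last x hx =>
    obtain ⟨b, p⟩ := x
    have hq : trace3 C D E (if b then 2 else 1, p) = (0, (trace D E (b, p)).2) := by
      rw [trace, isOuter_swap] at hx
      cases b
      · exact trace3_of_lt C D E 1 p ((isOuter_false _).mp hx)
      · exact trace3_of_le C D E 2 p ((isOuter_true _).mp hx)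
    have h2 := Ret.last (f := trace3 C D E) (O := BdR) (h := fragHeight3 C D E)
      (if b then 2 else 1, p) (by rw [hq]; exact Or.inl rfl)
    rw [hq] at h2
    cases b <;> exact h2
  | step x y m hx hr ih =>
    obtain ⟨b, p⟩ := x
    have hq : trace3 C D E (if b then 2 else 1, p) =
        (if (trace D E (b, p)).1 then 2 else 1, (trace D E (b, p)).2) := by
      rw [trace, isOuter_swap] at hx
      cases b
      · exact trace3_of_le C D E 1 p (not_lt.mp (mt (isOuter_false _).mpr hx))
      · exact trace3_of_lt C D E 2 p (not_le.mp (mt (isOuter_true _).mpr hx))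
    rw [← hq] at ih
    have h2 := Ret.step _ _ _ (by
      rw [hq]
      generalize trace D E (b, p) = z at hx
      obtain ⟨c, q⟩ := z
      cases c <;> simp [IsOuter, BdR] at hx ⊢ <;> exact hx) ih
    cases b <;> exact h2

theorem ret_embL (C D E : OkadaDiagram N) (x : Bool × Fin (2 * N)) :
    Ret (trace3 C D E) BdL (fragHeight3 C D E) (embL x) (embL (trace (C * D) E x))
      (fragHeight (C * D) E x) := by
  obtain ⟨b, p⟩ := x
  cases b with
  | false =>
    have h := ret_left C D E (ret_comp C D p)
    have h1 : embL (false, p) = (if (entry p).1 then 1 else 0, (entry p).2) := by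
      by_cases hp : N ≤ (p : ℕ)
      · simp [embL, entry, hp, not_lt.mpr hp]
      · simp [embL, entry, hp, not_le.mp hp]
    rw [h1]
    exact h
  | true =>
    have hq : trace3 C D E (2, p) = embL (trace (C * D) E (true, p)) := by
      have := (E.partner p).isLt
      by_cases hp : (E.partner p : ℕ) < N
      · have h3 : ¬ ((E.partner p).rev : ℕ) < N := by rw [Fin.val_rev]; omega
        refine (trace3_of_lt C D E 2 p hp).trans (Prod.ext ?_ rfl)
        simp only [trace, swap, across, pick, embL, Bool.not_true, if_neg h3]
        rfl
      · have h3 : ((E.partner p).rev : ℕ) < N := by rw [Fin.val_rev]; omega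
        refine (trace3_of_le C D E 2 p (not_lt.mp hp)).trans (Prod.ext ?_ rfl)
        simp only [trace, swap, across, pick, embL, Bool.not_true, if_pos h3]
        rfl
    have h2 := Ret.last (f := trace3 C D E) (O := BdL) (h := fragHeight3 C D E) (2, p) (by
      rw [hq]
      simp only [trace, swap, across, embL, BdL, Bool.not_true]
      generalize ((pick (C * D) E true).partner p).rev = q
      by_cases h : (q : ℕ) < N
      · simp [h]
      · simp [h]; omega)
    rw [hq] at h2
    exact h2

theorem ret_embR (C D E : OkadaDiagram N) (x : Bool × Fin (2 * N)) :
    Ret (trace3 C D E) BdR (fragHeight3 C D E) (embR x) (embR (trace C (D * E) x))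
      (fragHeight C (D * E) x) := by
  obtain ⟨b, p⟩ := x
  cases b with
  | true =>
    have h := ret_right C D E (ret_comp D E p)
    have h1 : embR (true, p) = (if (entry p).1 then 2 else 1, (entry p).2) := by
      by_cases hp : N ≤ (p : ℕ)
      · simp [embR, entry, hp, not_lt.mpr hp]
      · simp [embR, entry, hp, not_le.mp hp]
    rw [h1]
    exact h
  | false =>
    have hq : trace3 C D E (0, p) = embR (trace C (D * E) (false, p)) := by
      have := (C.partner p).isLt
      by_cases hp : (C.partner p : ℕ) < N
      · have h3 : ¬ ((C.partner p).rev : ℕ) < N := by rw [Fin.val_rev]; omega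
        refine (trace3_of_lt C D E 0 p hp).trans (Prod.ext ?_ rfl)
        simp only [trace, swap, across, pick, embR, Bool.not_false, if_neg h3]
        rfl
      · have h3 : ((C.partner p).rev : ℕ) < N := by rw [Fin.val_rev]; omega
        refine (trace3_of_le C D E 0 p (not_lt.mp hp)).trans (Prod.ext ?_ rfl)
        simp only [trace, swap, across, pick, embR, Bool.not_false, if_pos h3]
        rfl
    have h2 := Ret.last (f := trace3 C D E) (O := BdR) (h := fragHeight3 C D E) (0, p) (by
      rw [hq]
      simp only [trace, swap, across, embR, BdR, Bool.not_false]
      generalize ((pick C (D * E) false).partner p).rev = q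
      by_cases h : (q : ℕ) < N
      · simp [h]
      · simp [h]; omega)
    rw [hq] at h2
    exact h2

theorem isOuter3_embL (x : Bool × Fin (2 * N)) : IsOuter3 (embL x) ↔ IsOuter x := by
  obtain ⟨b, p⟩ := x
  cases b <;> by_cases hp : (p : ℕ) < N <;> simp [IsOuter3, IsOuter, embL, hp]

theorem isOuter3_embR (x : Bool × Fin (2 * N)) : IsOuter3 (embR x) ↔ IsOuter x := by
  obtain ⟨b, p⟩ := x
  cases b <;> by_cases hp : (p : ℕ) < N <;> simp [IsOuter3, IsOuter, embR, hp]

theorem embL_entry (p : Fin (2 * N)) : embL (entry p) = embR (entry p) := by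
  by_cases hp : N ≤ (p : ℕ)
  · simp [embL, embR, entry, hp, not_lt.mpr hp]
  · simp [embL, embR, entry, hp, not_le.mp hp]

protected theorem mul_assoc (C D E : OkadaDiagram N) : C * D * E = C * (D * E) := by
  have key : ∀ p, (C * D * E).partner p = (C * (D * E)).partner p ∧
      (C * D * E).height p = (C * (D * E)).height p := by
    intro p
    have h1 := Ret.blocks (O := IsOuter3) embL (fun x hx => by
      unfold IsOuter3 BdL at *; tauto) isOuter3_embL (ret_embL C D E) (ret_comp (C * D) E p)
    have h2 := Ret.blocks (O := IsOuter3) embR (fun x hx => by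
      unfold IsOuter3 BdR at *; tauto) isOuter3_embR (ret_embR C D E) (ret_comp C (D * E) p)
    rw [embL_entry] at h1
    obtain ⟨e1, e2⟩ := h1.unique h2
    exact ⟨Fin.rev_injective (congrArg Prod.snd e1), e2⟩
  ext p
  · exact congrArg Fin.val (key p).1
  · exact (key p).2

theorem min_height_abs (D : OkadaDiagram N) (p : Fin (2 * N)) :
    min (D.height p) (vertexAbs (D.partner p)) = D.height p ∧
      min (vertexAbs p) (D.height p) = D.height p := by
  have := D.height_le p
  omega

theorem vertexAbs_rev (p : Fin (2 * N)) : vertexAbs p.rev = vertexAbs p :=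
  (1 : OkadaDiagram N).height_partner p

protected theorem one_mul (D : OkadaDiagram N) : 1 * D = D := by
  have aux : ∀ p, Ret (trace 1 D) IsOuter (fragHeight 1 D) (true, p)
      (swap (entry (D.partner p))) (D.height p) := by
    intro p
    by_cases hq : N ≤ (D.partner p : ℕ)
    · have e : swap (entry (D.partner p)) = trace 1 D (true, p) := by
        simp [trace, across, pick, entry, hq]
      rw [e]
      exact Ret.last _ (by rw [← e, isOuter_swap]; exact isOuter_entry _)
    · have e1 : trace 1 D (true, p) = (false, (D.partner p).rev) := rfl
      have e2 : swap (entry (D.partner p)) = trace 1 D (false, (D.partner p).rev) := by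
        simp [trace, across, pick, entry, hq, one_partner]
      have h := Ret.last (f := trace 1 D) (O := IsOuter) (h := fragHeight 1 D)
        (false, (D.partner p).rev) (by rw [← e2, isOuter_swap]; exact isOuter_entry _)
      rw [← e2] at h
      have h2 := Ret.step (f := trace 1 D) (true, p) _ _ (by
        rw [e1]; simp [IsOuter, Fin.val_rev]; omega) (e1 ▸ h)
      have h3 : min (fragHeight 1 D (true, p)) (fragHeight 1 D (false, (D.partner p).rev)) =
          D.height p := by
        simp only [fragHeight, pick, one_height, vertexAbs_rev]
        exact (min_height_abs D p).1
      rw [e1, h3] at h2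
      exact h2
  apply eq_of_ret
  intro p
  by_cases hp : N ≤ (p : ℕ)
  · simpa [entry, hp] using aux p
  · have e1 : trace 1 D (entry p) = (true, p) := by
      simp [trace, across, pick, entry, hp, one_partner, swap]
    have h2 := Ret.step (f := trace 1 D) (entry p) _ _ (by
      rw [e1]; simp [IsOuter]; omega) (e1 ▸ aux p)
    have h3 : min (fragHeight 1 D (entry p)) (D.height p) = D.height p := by
      simp only [fragHeight, pick, entry, hp, decide_false, one_height]
      exact (min_height_abs D p).2
    rwa [h3] at h2

protected theorem mul_one (D : OkadaDiagram N) : D * 1 = D := by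
  have aux : ∀ p, Ret (trace D 1) IsOuter (fragHeight D 1) (false, p)
      (swap (entry (D.partner p))) (D.height p) := by
    intro p
    by_cases hq : N ≤ (D.partner p : ℕ)
    · have e1 : trace D 1 (false, p) = (true, (D.partner p).rev) := rfl
      have e2 : swap (entry (D.partner p)) = trace D 1 (true, (D.partner p).rev) := by
        simp [trace, across, pick, entry, hq, one_partner]
      have h := Ret.last (f := trace D 1) (O := IsOuter) (h := fragHeight D 1)
        (true, (D.partner p).rev) (by rw [← e2, isOuter_swap]; exact isOuter_entry _)
      rw [← e2] at h
      have h2 := Ret.step (f := trace D 1) (false, p) _ _ (by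
        rw [e1]; simp [IsOuter, Fin.val_rev]; omega) (e1 ▸ h)
      have h3 : min (fragHeight D 1 (false, p)) (fragHeight D 1 (true, (D.partner p).rev)) =
          D.height p := by
        simp only [fragHeight, pick, one_height, vertexAbs_rev]
        exact (min_height_abs D p).1
      rw [e1, h3] at h2
      exact h2
    · have e : swap (entry (D.partner p)) = trace D 1 (false, p) := by
        simp [trace, across, pick, entry, hq]
      rw [e]
      exact Ret.last _ (by rw [← e, isOuter_swap]; exact isOuter_entry _)
  apply eq_of_ret
  intro p
  by_cases hp : N ≤ (p : ℕ)
  · have e1 : trace D 1 (entry p) = (false, p) := by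
      simp [trace, across, pick, entry, hp, one_partner, swap]
    have h2 := Ret.step (f := trace D 1) (entry p) _ _ (by
      rw [e1]; simp [IsOuter]; omega) (e1 ▸ aux p)
    have h3 : min (fragHeight D 1 (entry p)) (D.height p) = D.height p := by
      simp only [fragHeight, pick, entry, hp, decide_true, one_height]
      exact (min_height_abs D p).2
    rwa [h3] at h2
  · simpa [entry, hp] using aux p

/-- The Okada monoid of rank `N`. -/
instance : Monoid (OkadaDiagram N) where
  mul_assoc := OkadaDiagram.mul_assoc
  one_mul := OkadaDiagram.one_mul
  mul_one := OkadaDiagram.mul_one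

/-! ### Mirror, propagating labels, free elements and Green relations -/

/-- The mirror of a diagram: exchange the vertices `a` and `\overline{a}`. -/
def mirror (D : OkadaDiagram N) : OkadaDiagram N where
  partner p := (D.partner p.rev).rev
  height p := D.height p.rev
  partner_partner p := by rw [Fin.rev_rev, D.partner_partner, Fin.rev_rev]
  partner_ne p h := D.partner_ne p.rev (by rw [← Fin.rev_inj, h, Fin.rev_rev])
  height_partner p := by rw [Fin.rev_rev, D.height_partner]
  noncrossing a c h1 h2 h3 := by
    have h4 : D.partner c.rev < D.partner a.rev := Fin.rev_lt_rev.mp h3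
    have h5 : D.partner a.rev < c.rev := by rw [← Fin.rev_lt_rev, Fin.rev_rev]; exact h2
    have h6 : c.rev < a.rev := Fin.rev_lt_rev.mpr h1
    exact D.noncrossing (D.partner c.rev) (D.partner a.rev) h4
      (by rwa [D.partner_partner]) (by rwa [D.partner_partner, D.partner_partner])
  one_le_height p := D.one_le_height _
  height_le p := by rw [vertexAbs_rev, ← vertexAbs_rev p]; exact D.height_le _
  height_parity p := by rw [vertexAbs_rev, ← vertexAbs_rev p]; exact D.height_parity _
  height_lt_of_nested a c h1 h2 h3 := by
    have h4 : D.partner c.rev < D.partner a.rev := Fin.rev_lt_rev.mp h3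
    have h5 : D.partner a.rev < a.rev := by rw [← Fin.rev_lt_rev, Fin.rev_rev]; exact h2
    have h6 : a.rev < c.rev := Fin.rev_lt_rev.mpr h1
    have := D.height_lt_of_nested (D.partner a.rev) (D.partner c.rev) h4
      (by rwa [D.partner_partner]) (by rwa [D.partner_partner, D.partner_partner])
    rwa [D.height_partner, D.height_partner] at this

/-- An element is involutive if it equals its mirror. -/
def IsInvolutive (e : OkadaDiagram N) : Prop := e = mirror e

/-- The propagating set of a diagram: the labels of the arcs that join a left vertex to a right
vertex. -/
def propLab (D : OkadaDiagram N) : Set ℕ :=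
  {h | ∃ p : Fin (2 * N), (p : ℕ) < N ∧ N ≤ (D.partner p : ℕ) ∧ D.height p = h}

/-- The partner function of an elementary diagram. -/
def elemPartner (i : Fin (N - 1)) (p : Fin (2 * N)) : Fin (2 * N) :=
  if vertexAbs p = (i : ℕ) + 1 then
    (if (p : ℕ) < N then ⟨i + 1, by omega⟩ else ⟨2 * N - 2 - i, by omega⟩)
  else if vertexAbs p = (i : ℕ) + 2 then
    (if (p : ℕ) < N then ⟨i, by omega⟩ else ⟨2 * N - 1 - i, by omega⟩)
  else p.rev

theorem elemPartner_val (i : Fin (N - 1)) (p : Fin (2 * N)) :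
    (elemPartner i p : ℕ) =
      if (p : ℕ) = i then (i : ℕ) + 1 else if (p : ℕ) = i + 1 then (i : ℕ)
      else if (p : ℕ) + 1 + i = 2 * N then 2 * N - 2 - i
      else if (p : ℕ) + 2 + i = 2 * N then 2 * N - 1 - i else 2 * N - 1 - p := by
  have := p.isLt
  have := i.isLt
  have h : (p.rev : ℕ) = 2 * N - 1 - p := by rw [Fin.val_rev]; omega
  unfold elemPartner vertexAbs
  split_ifs <;> first | omega | simp only []

theorem elemPartner_through (i : Fin (N - 1)) (c : Fin (2 * N))
    (h : (c : ℕ) + 1 < elemPartner i c) :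
    (elemPartner i c : ℕ) = 2 * N - 1 - c ∧ (c : ℕ) < N ∧ vertexAbs c ≠ (i : ℕ) + 2 := by
  have := c.isLt
  have := i.isLt
  rw [elemPartner_val] at h ⊢
  unfold vertexAbs
  split_ifs at h ⊢ <;> omega

theorem vertexAbs_elemPartner (i : Fin (N - 1)) (p : Fin (2 * N)) :
    vertexAbs (elemPartner i p) = if vertexAbs p = (i : ℕ) + 1 then (i : ℕ) + 2
      else if vertexAbs p = (i : ℕ) + 2 then (i : ℕ) + 1 else vertexAbs p := by
  have := p.isLt
  have := i.isLt
  have h := vertexAbs_rev p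
  unfold elemPartner
  by_cases h1 : vertexAbs p = (i : ℕ) + 1
  · simp only [if_pos h1]
    unfold vertexAbs at *
    split_ifs at * <;> simp only [] at * <;> omega
  · by_cases h2 : vertexAbs p = (i : ℕ) + 2
    · simp only [if_neg h1, if_pos h2]
      unfold vertexAbs at *
      split_ifs at * <;> simp only [] at * <;> omega
    · simp only [if_neg h1, if_neg h2, h]

/-- The elementary diagram with index `j = i + 1`, where `1 ≤ j ≤ N - 1`: it has the arcs
`j - (j+1)` and `\overline{j} - \overline{j+1}`, both with label `j`, and the arcs
`a - \overline{a}` with label `a` for `a ≠ j, j + 1`. -/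
def elementary (i : Fin (N - 1)) : OkadaDiagram N where
  partner := elemPartner i
  height p := if vertexAbs p = (i : ℕ) + 2 then (i : ℕ) + 1 else vertexAbs p
  partner_partner p := by
    have := p.isLt
    have := i.isLt
    rw [Fin.ext_iff, elemPartner_val, elemPartner_val]
    split_ifs <;> omega
  partner_ne p := by
    have := p.isLt
    have := i.isLt
    rw [Ne, Fin.ext_iff, elemPartner_val]
    split_ifs <;> omega
  height_partner p := by
    rw [vertexAbs_elemPartner]
    split_ifs <;> omega
  noncrossing a c := by
    have := a.isLt
    have := c.isLt
    have := i.isLt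
    simp only [Fin.lt_def]
    intro h1 h2 h3
    have ha := elemPartner_through i a (by omega)
    rw [ha.1] at h2 h3
    rw [elemPartner_val] at h3
    split_ifs at h3 <;> omega
  one_le_height p := by
    have := p.isLt
    unfold vertexAbs
    split_ifs <;> omega
  height_le p := by
    rw [vertexAbs_elemPartner]
    split_ifs <;> omega
  height_parity p := by
    rw [vertexAbs_elemPartner]
    unfold Nat.ModEq
    split_ifs <;> omega
  height_lt_of_nested a c := by
    have := a.isLt
    have := c.isLt
    have := i.isLt
    simp only [Fin.lt_def]
    intro h1 h2 h3
    obtain ⟨hc1, hc2, hc3⟩ := elemPartner_through i c (by omega)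
    rw [if_neg hc3]
    rw [hc1] at h3
    rw [elemPartner_val] at h2 h3
    unfold vertexAbs at hc3 ⊢
    rw [if_pos hc2] at hc3 ⊢
    split_ifs at h2 h3 ⊢ <;> omega

/-- `e` and `f` generate the same right ideal. -/
def GreenR (e f : OkadaDiagram N) : Prop :=
  Set.range (fun g : OkadaDiagram N => e * g) = Set.range (fun g : OkadaDiagram N => f * g)

/-- `e` and `f` generate the same two-sided ideal. -/
def GreenJ (e f : OkadaDiagram N) : Prop :=
  Set.range (fun g : OkadaDiagram N × OkadaDiagram N => g.1 * e * g.2) =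
    Set.range (fun g : OkadaDiagram N × OkadaDiagram N => g.1 * f * g.2)

end OkadaDiagram

/-- Fibonacci sets of rank `N`: subsets `{s₁ < ⋯ < s_k}` of `{1, …, N}` such that `k` has the
parity of `N` and `s_l` has the parity of `l` for all `l`. -/
def IsFibonacciSet (N : ℕ) (S : Finset ℕ) : Prop :=
  S ⊆ Finset.Icc 1 N ∧ S.card ≡ N [MOD 2] ∧
    ∀ s ∈ S, s ≡ (S.filter (fun t => t ≤ s)).card [MOD 2]

/-- The free set of a Fibonacci set `S`: the indices `j = i + 1 ∉ S` such that
`j - max {s ∈ S | s < j}` is odd, where the maximum of the empty set is `0`. -/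
def freeSet (N : ℕ) (S : Finset ℕ) : Finset (Fin (N - 1)) :=
  Finset.univ.filter (fun i => (i : ℕ) + 1 ∉ S ∧
    Odd ((i : ℕ) + 1 - (S.filter (fun s => s < (i : ℕ) + 1)).sup id))

namespace OkadaDiagram

/-- The product of the (pairwise commuting) elementary diagrams with index in the free set of a
Fibonacci set `S`. -/
def freeElement (N : ℕ) (S : Finset ℕ) : OkadaDiagram N :=
  (((freeSet N S).sort (fun a b => a ≤ b)).map elementary).prod

/-- An element is free if it is the free element of some Fibonacci set. -/
def IsFree {N : ℕ} (e : OkadaDiagram N) : Prop :=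
  ∃ S : Finset ℕ, IsFibonacciSet N S ∧ e = freeElement N S

end OkadaDiagram

namespace OkadaDiagram

variable {N : ℕ}

/-! ### Short paths in a product -/

/-! Cut a diagram in the middle. Its left half consists of the arcs between left vertices and the
labels at all left vertices. In a product `C * D` every arc of `C` between left vertices survives
with its label, and no label at a left vertex exceeds its label in `C`. Hence R-equivalent diagrams
have the same left half (`GreenR.sameLeft`).

Write e* for the mirror of e. Then e e* is involutive, has the left half of e, and satisfies e e* e
= e, so it is R-equivalent to e. Labels of propagating arcs increase strictly towards the inside. In
an involutive diagram a propagating arc and its mirror image have the same label, so they coincide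
and the arc joins a vertex to its own mirror image. An involutive diagram is thus determined by its
left half (`SameLeft.eq_of_isInvolutive`). So R-classes correspond to left halves, and e e* is the
only involutive element in the class of e.

For two-sided ideals, the number of propagating arcs with label at least t cannot grow under
multiplication on either side. These numbers, for all t, determine the propagating set, which is
therefore an invariant of the J-class. Conversely, if e and f have the same propagating set, the
left half of e can be glued to the right half of f by joining propagating ends with equal labels
(`glue`). The result is R-equivalent to e and its mirror is R-equivalent to f*, so e and f are
J-equivalent (`greenJ_iff_propLab_eq`).

It remains to match propagating sets with free elements. Counting the vertices of an initial segment
modulo 2 shows that propagating sets are Fibonacci sets (`isFibonacciSet_propFinset`). The free set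
of a Fibonacci set S tiles the complement of S by pairs of consecutive integers, so the free element
of S has propagating set S (`propLab_freeElement`). -/

theorem mul_eq_of_ret {C D : OkadaDiagram N} {p q : Fin (2 * N)} {m : ℕ}
    (h : Ret (trace C D) IsOuter (fragHeight C D) (entry p) (swap (entry q)) m) :
    (C * D).partner p = q ∧ (C * D).height p = m := by
  obtain ⟨h1, h2⟩ := (ret_comp C D p).unique h
  refine ⟨?_, h2⟩
  have := congrArg (fun x => (swap x).2) h1
  simp only [swap_swap] at this
  exact this

theorem entry_of_lt {p : Fin (2 * N)} (hp : (p : ℕ) < N) : entry p = (false, p) := by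
  simp [entry, hp]

theorem entry_of_le {p : Fin (2 * N)} (hp : N ≤ (p : ℕ)) : entry p = (true, p) := by
  simp [entry, hp]

theorem rev_lt_iff (p : Fin (2 * N)) : (p.rev : ℕ) < N ↔ N ≤ (p : ℕ) := by
  have := p.isLt
  rw [Fin.val_rev]; omega

theorem le_rev_iff (p : Fin (2 * N)) : N ≤ (p.rev : ℕ) ↔ (p : ℕ) < N := by
  have := p.isLt
  rw [Fin.val_rev]; omega

/-- This and the next three lemmas let a path be computed arc by arc. An arc of `C` ends the path if
it arrives on the left and otherwise leads into `D`; an arc of `D` ends the path if it arrives on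
the right and otherwise leads back into `C`. -/
theorem ret_false_last (C D : OkadaDiagram N) {p : Fin (2 * N)} (h : (C.partner p : ℕ) < N) :
    Ret (trace C D) IsOuter (fragHeight C D) (false, p) (swap (entry (C.partner p)))
      (C.height p) := by
  have e : swap (entry (C.partner p)) = trace C D (false, p) := by
    rw [entry_of_lt h]; rfl
  rw [e]
  exact Ret.last _ (by rw [← e, isOuter_swap]; exact isOuter_entry _)

theorem ret_true_last (C D : OkadaDiagram N) {p : Fin (2 * N)} (h : N ≤ (D.partner p : ℕ)) :
    Ret (trace C D) IsOuter (fragHeight C D) (true, p) (swap (entry (D.partner p)))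
      (D.height p) := by
  have e : swap (entry (D.partner p)) = trace C D (true, p) := by
    rw [entry_of_le h]; rfl
  rw [e]
  exact Ret.last _ (by rw [← e, isOuter_swap]; exact isOuter_entry _)

theorem ret_false_step (C D : OkadaDiagram N) {p : Fin (2 * N)} (h : N ≤ (C.partner p : ℕ))
    {y : Bool × Fin (2 * N)} {m : ℕ}
    (hr : Ret (trace C D) IsOuter (fragHeight C D) (true, (C.partner p).rev) y m) :
    Ret (trace C D) IsOuter (fragHeight C D) (false, p) y (min (C.height p) m) := by
  refine Ret.step (false, p) y m ?_ hr
  rw [trace, isOuter_swap]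
  exact fun h2 => absurd ((isOuter_false _).mp h2) (not_lt.mpr h)

theorem ret_true_step (C D : OkadaDiagram N) {p : Fin (2 * N)} (h : (D.partner p : ℕ) < N)
    {y : Bool × Fin (2 * N)} {m : ℕ}
    (hr : Ret (trace C D) IsOuter (fragHeight C D) (false, (D.partner p).rev) y m) :
    Ret (trace C D) IsOuter (fragHeight C D) (true, p) y (min (D.height p) m) := by
  refine Ret.step (true, p) y m ?_ hr
  rw [trace, isOuter_swap]
  exact fun h2 => absurd ((isOuter_true _).mp h2) (not_le.mpr h)

/-- A left arc of the left factor is an arc of the product. -/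
theorem mul_of_left_arc (C D : OkadaDiagram N) {p : Fin (2 * N)} (hp : (p : ℕ) < N)
    (h : (C.partner p : ℕ) < N) :
    (C * D).partner p = C.partner p ∧ (C * D).height p = C.height p :=
  mul_eq_of_ret (by rw [entry_of_lt hp]; exact ret_false_last C D h)

/-- Two propagating arcs that meet form an arc of the product. -/
theorem mul_of_through (C D : OkadaDiagram N) {p : Fin (2 * N)} (hp : (p : ℕ) < N)
    (h : N ≤ (C.partner p : ℕ)) (h2 : N ≤ (D.partner (C.partner p).rev : ℕ)) :
    (C * D).partner p = D.partner (C.partner p).rev ∧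
      (C * D).height p = min (C.height p) (D.height (C.partner p).rev) :=
  mul_eq_of_ret (by
    rw [entry_of_lt hp]; exact ret_false_step C D h (ret_true_last C D h2))

/-- Two propagating arcs of the left factor joined by a left arc of the right factor. -/
theorem mul_of_bounce (C D : OkadaDiagram N) {p : Fin (2 * N)} (hp : (p : ℕ) < N)
    (h : N ≤ (C.partner p : ℕ)) (h2 : (D.partner (C.partner p).rev : ℕ) < N)
    (h3 : (C.partner (D.partner (C.partner p).rev).rev : ℕ) < N) :
    (C * D).partner p = C.partner (D.partner (C.partner p).rev).rev :=
  (mul_eq_of_ret (by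
    rw [entry_of_lt hp]
    exact ret_false_step C D h (ret_true_step C D h2 (ret_false_last C D h3)))).1

theorem le_of_mul_le (C D : OkadaDiagram N) {p : Fin (2 * N)} (hp : (p : ℕ) < N)
    (h : N ≤ ((C * D).partner p : ℕ)) : N ≤ (C.partner p : ℕ) := by
  by_contra h2
  rw [(mul_of_left_arc C D hp (not_le.mp h2)).1] at h
  exact h2 h

/-- The path from a left vertex begins with the arc of `C` there, and the label of the path is a
minimum. -/
theorem mul_height_le (C D : OkadaDiagram N) {p : Fin (2 * N)} (hp : (p : ℕ) < N) :
    (C * D).height p ≤ C.height p := by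
  have := compHeight_le C D p (compLength_pos C D p)
  rwa [Function.iterate_zero_apply, entry_of_lt hp] at this

/-! ### The mirror -/

theorem mirror_mirror (D : OkadaDiagram N) : mirror (mirror D) = D := by
  ext p <;> simp [mirror]

theorem mirror_partner (D : OkadaDiagram N) (p : Fin (2 * N)) :
    (mirror D).partner p = (D.partner p.rev).rev := rfl

theorem mirror_height (D : OkadaDiagram N) (p : Fin (2 * N)) :
    (mirror D).height p = D.height p.rev := rfl

/-- The state that corresponds to a state in the mirrored concatenation. -/
def mirrorState (x : Bool × Fin (2 * N)) : Bool × Fin (2 * N) := (!x.1, x.2.rev)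

/-- `mirrorState` is the same function as `swap`. Here it reads a vertex of one factor as the
reflected vertex of the mirrored factor, which has changed places with the other one. -/
theorem isOuter_mirrorState (x : Bool × Fin (2 * N)) : IsOuter (mirrorState x) ↔ IsOuter x :=
  isOuter_swap x

theorem entry_rev (p : Fin (2 * N)) : entry p.rev = mirrorState (entry p) := by
  by_cases h : N ≤ (p : ℕ)
  · rw [entry_of_le h, entry_of_lt ((rev_lt_iff p).mpr h)]; rfl
  · rw [entry_of_lt (not_le.mp h), entry_of_le ((le_rev_iff p).mpr (not_le.mp h))]; rfl

theorem trace_mirror (C D : OkadaDiagram N) (x : Bool × Fin (2 * N)) :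
    trace (mirror D) (mirror C) (mirrorState x) = mirrorState (trace C D x) := by
  obtain ⟨b, p⟩ := x
  cases b <;> simp [trace, swap, across, pick, mirrorState, mirror_partner]

theorem fragHeight_mirror (C D : OkadaDiagram N) (x : Bool × Fin (2 * N)) :
    fragHeight (mirror D) (mirror C) (mirrorState x) = fragHeight C D x := by
  obtain ⟨b, p⟩ := x
  cases b <;> simp [fragHeight, pick, mirrorState, mirror_height]

theorem ret_mirror (C D : OkadaDiagram N) {x y : Bool × Fin (2 * N)} {m : ℕ}
    (h : Ret (trace C D) IsOuter (fragHeight C D) x y m) :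
    Ret (trace (mirror D) (mirror C)) IsOuter (fragHeight (mirror D) (mirror C))
      (mirrorState x) (mirrorState y) m := by
  induction h with
  | last x hx =>
    rw [← trace_mirror, ← fragHeight_mirror]
    exact Ret.last _ (by rwa [trace_mirror, isOuter_mirrorState])
  | step x y m hx hr ih =>
    rw [← fragHeight_mirror]
    rw [← trace_mirror] at ih
    exact Ret.step _ _ _ (by rwa [trace_mirror, isOuter_mirrorState]) ih

/-- Reflecting the whole concatenation exchanges the two factors and carries paths to paths with the
same labels. -/
theorem mirror_mul (C D : OkadaDiagram N) : mirror (C * D) = mirror D * mirror C := by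
  symm
  apply eq_of_ret
  intro p
  have h := ret_mirror C D (ret_comp C D p.rev)
  rw [← entry_rev, Fin.rev_rev] at h
  rw [mirror_partner, mirror_height, entry_rev]
  exact h

/-! ### Propagating arcs -/

/-- Labels increase strictly along the left ends of propagating arcs. -/
theorem height_lt_of_propagating (D : OkadaDiagram N) {p q : Fin (2 * N)} (hq : (q : ℕ) < N)
    (hp' : N ≤ (D.partner p : ℕ)) (hq' : N ≤ (D.partner q : ℕ)) (h : p < q) :
    D.height p < D.height q := by
  -- `q` is a left vertex and the arc of `p` ends on the right, so `q` lies under that arc.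
  -- Non-crossing puts the whole arc of `q` there, and nested arcs have larger labels.
  have hqp : q < D.partner p := by rw [Fin.lt_def]; omega
  have := (partner_mem_between D h hqp).2
  exact D.height_lt_of_nested q p h (by rw [Fin.lt_def]; omega) this

/-- By strict monotonicity, a propagating arc is identified by its label. Both the rigidity of
involutive diagrams and the uniqueness of gluing rest on this. -/
theorem eq_of_height_eq (D : OkadaDiagram N) {p q : Fin (2 * N)} (hp : (p : ℕ) < N)
    (hq : (q : ℕ) < N) (hp' : N ≤ (D.partner p : ℕ)) (hq' : N ≤ (D.partner q : ℕ))
    (h : D.height p = D.height q) : p = q := by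
  rcases lt_trichotomy p q with h1 | h1 | h1
  · exact absurd h (height_lt_of_propagating D hq hp' hq' h1).ne
  · exact h1
  · exact absurd h (height_lt_of_propagating D hp hq' hp' h1).ne'

/-- Mirror image of `height_lt_of_propagating`. On the right the smaller positions are the inner
ones, so the order is reversed. -/
theorem height_lt_of_propagating_right (D : OkadaDiagram N) {p q : Fin (2 * N)}
    (hq : N ≤ (q : ℕ)) (hp' : (D.partner p : ℕ) < N) (hq' : (D.partner q : ℕ) < N)
    (h : q < p) : D.height p < D.height q := by
  have := height_lt_of_propagating (mirror D) (p := p.rev) (q := q.rev)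
    ((rev_lt_iff q).mpr hq) (by rwa [mirror_partner, Fin.rev_rev, le_rev_iff])
    (by rwa [mirror_partner, Fin.rev_rev, le_rev_iff]) (Fin.rev_lt_rev.mpr h)
  simpa [mirror_height] using this

theorem eq_of_height_eq_right (D : OkadaDiagram N) {p q : Fin (2 * N)} (hp : N ≤ (p : ℕ))
    (hq : N ≤ (q : ℕ)) (hp' : (D.partner p : ℕ) < N) (hq' : (D.partner q : ℕ) < N)
    (h : D.height p = D.height q) : p = q := by
  rcases lt_trichotomy p q with h1 | h1 | h1
  · exact absurd h (height_lt_of_propagating_right D hp hq' hp' h1).ne'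
  · exact h1
  · exact absurd h (height_lt_of_propagating_right D hq hp' hq' h1).ne

/-! ### Left halves -/

/-- Two diagrams have the same left half: the same left arcs, and the same labels at left
vertices. -/
def SameLeft (D E : OkadaDiagram N) : Prop :=
  ∀ p : Fin (2 * N), (p : ℕ) < N → D.height p = E.height p ∧
    ((D.partner p : ℕ) < N → E.partner p = D.partner p) ∧
    ((E.partner p : ℕ) < N → D.partner p = E.partner p)

theorem SameLeft.symm {D E : OkadaDiagram N} (h : SameLeft D E) : SameLeft E D := fun p hp =>
  ⟨(h p hp).1.symm, (h p hp).2.2, (h p hp).2.1⟩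

theorem SameLeft.trans {D E F : OkadaDiagram N} (h : SameLeft D E) (h' : SameLeft E F) :
    SameLeft D F := fun p hp =>
  ⟨(h p hp).1.trans (h' p hp).1,
    fun h1 => by
      have e := (h p hp).2.1 h1
      rw [(h' p hp).2.1 (e ▸ h1), e],
    fun h1 => by
      have e := (h' p hp).2.2 h1
      rw [(h p hp).2.2 (e ▸ h1), e]⟩

theorem SameLeft.le_partner {D E : OkadaDiagram N} (h : SameLeft D E) {p : Fin (2 * N)}
    (hp : (p : ℕ) < N) (h2 : N ≤ (D.partner p : ℕ)) : N ≤ (E.partner p : ℕ) := by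
  by_contra h3
  rw [(h p hp).2.2 (not_le.mp h3)] at h2
  exact h3 h2

/-- Left arcs of `D` survive. A propagating arc of `D` meets its own mirror image, which leads back
to the reflection of its starting point; both carry the same label, so the minimum changes nothing.
-/
theorem mul_mirror_apply (D : OkadaDiagram N) {p : Fin (2 * N)} (hp : (p : ℕ) < N) :
    (D * mirror D).partner p = (if (D.partner p : ℕ) < N then D.partner p else p.rev) ∧
      (D * mirror D).height p = D.height p := by
  split_ifs with h
  · exact mul_of_left_arc D _ hp h
  · have e : (mirror D).partner (D.partner p).rev = p.rev := by
      rw [mirror_partner, Fin.rev_rev, D.partner_partner]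
    have h2 := mul_of_through D (mirror D) hp (not_lt.mp h)
      (by rw [e]; exact (le_rev_iff p).mpr hp)
    rw [e, mirror_height, Fin.rev_rev, D.height_partner, min_self] at h2
    exact h2

theorem sameLeft_mul_mirror (D : OkadaDiagram N) : SameLeft D (D * mirror D) := by
  intro p hp
  obtain ⟨h1, h2⟩ := mul_mirror_apply D hp
  rw [h1, h2]
  refine ⟨rfl, fun h => if_pos h, fun h => ?_⟩
  split_ifs at h ⊢ with h3
  · rfl
  · exact absurd ((le_rev_iff p).mpr hp) (not_le.mpr h)

theorem isInvolutive_mul_mirror (D : OkadaDiagram N) : IsInvolutive (D * mirror D) := by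
  rw [IsInvolutive, mirror_mul, mirror_mirror]

theorem mul_mirror_mul_apply (D : OkadaDiagram N) {p : Fin (2 * N)} (hp : (p : ℕ) < N) :
    (D * mirror D * D).partner p = D.partner p ∧
      (D * mirror D * D).height p = D.height p := by
  obtain ⟨h1, h2⟩ := mul_mirror_apply D hp
  split_ifs at h1 with h
  · have := mul_of_left_arc (D * mirror D) D hp (by rwa [h1])
    rwa [h1, h2] at this
  · have := mul_of_through (D * mirror D) D hp (by rw [h1]; exact (le_rev_iff p).mpr hp)
      (by rw [h1, Fin.rev_rev]; exact not_lt.mp h)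
    rwa [h1, h2, Fin.rev_rev, min_self] at this

/-- Each diagram is regular: its mirror is an inverse. -/
theorem mul_mirror_mul (D : OkadaDiagram N) : D * mirror D * D = D := by
  have key : ∀ p, (D * mirror D * D).partner p = D.partner p ∧
      (D * mirror D * D).height p = D.height p := by
    intro p
    by_cases hp : (p : ℕ) < N
    · exact mul_mirror_mul_apply D hp
    -- Right vertices are left vertices of the mirror, and the triple product has the same form for
    -- `mirror D`.
    · have h := mul_mirror_mul_apply (mirror D) ((rev_lt_iff p).mpr (not_lt.mp hp))
      have e : mirror D * mirror (mirror D) * mirror D = mirror (D * mirror D * D) := by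
        rw [mirror_mul, mirror_mul, mul_assoc]
      rw [e, mirror_partner, mirror_partner, mirror_height, mirror_height, Fin.rev_rev,
        Fin.rev_inj] at h
      exact h
  ext p
  · exact congrArg Fin.val (key p).1
  · exact (key p).2

/-- The mirror image of a propagating arc of `f` is again a propagating arc of `f` with the same
label. By `eq_of_height_eq` the two have the same left end, so the arc is its own mirror image. -/
theorem IsInvolutive.partner_eq_rev {f : OkadaDiagram N} (hf : f.IsInvolutive)
    {p : Fin (2 * N)} (hp : (p : ℕ) < N) (h : N ≤ (f.partner p : ℕ)) : f.partner p = p.rev := by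
  have e1 : f.partner (f.partner p).rev = p.rev := by
    have := congrArg (fun d => d.partner (f.partner p).rev) hf
    simpa [mirror_partner, f.partner_partner] using this
  have e2 : f.height (f.partner p).rev = f.height p := by
    have := congrArg (fun d => d.height (f.partner p).rev) hf
    simpa [mirror_height, f.height_partner] using this
  have := eq_of_height_eq f ((rev_lt_iff _).mpr h) hp
    (by rw [e1]; exact (le_rev_iff p).mpr hp) h e2
  rw [← this, Fin.rev_rev]; rw [this]

/-- An involutive diagram is determined by its left half. -/
theorem SameLeft.eq_of_isInvolutive {e f : OkadaDiagram N} (h : SameLeft e f)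
    (he : e.IsInvolutive) (hf : f.IsInvolutive) : e = f := by
  have key : ∀ p : Fin (2 * N), (p : ℕ) < N →
      e.partner p = f.partner p ∧ e.height p = f.height p := by
    intro p hp
    refine ⟨?_, (h p hp).1⟩
    by_cases h1 : (e.partner p : ℕ) < N
    · exact ((h p hp).2.1 h1).symm
    · rw [he.partner_eq_rev hp (not_lt.mp h1),
        hf.partner_eq_rev hp (h.le_partner hp (not_lt.mp h1))]
  have key2 : ∀ p : Fin (2 * N), e.partner p = f.partner p ∧ e.height p = f.height p := by
    intro p
    by_cases hp : (p : ℕ) < N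
    · exact key p hp
    · obtain ⟨h1, h2⟩ := key p.rev ((rev_lt_iff p).mpr (not_lt.mp hp))
      rw [he, hf]
      exact ⟨by rw [mirror_partner, mirror_partner, h1], h2⟩
  ext p
  · exact congrArg Fin.val (key2 p).1
  · exact (key2 p).2

/-! ### Green relations -/

theorem greenR_iff (e f : OkadaDiagram N) :
    GreenR e f ↔ (∃ g, e * g = f) ∧ ∃ g, f * g = e := by
  constructor
  · intro h
    exact ⟨(Set.ext_iff.mp h f).mpr ⟨1, mul_one f⟩, (Set.ext_iff.mp h e).mp ⟨1, mul_one e⟩⟩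
  · rintro ⟨⟨g, rfl⟩, g', hg⟩
    ext x
    constructor
    · rintro ⟨y, rfl⟩
      exact ⟨g' * y, by simp only [← mul_assoc, hg]⟩
    · rintro ⟨y, rfl⟩
      exact ⟨g * y, by simp only [mul_assoc]⟩

theorem greenJ_iff (e f : OkadaDiagram N) :
    GreenJ e f ↔ (∃ a b, a * e * b = f) ∧ ∃ a b, a * f * b = e := by
  constructor
  · intro h
    obtain ⟨⟨a, b⟩, h1⟩ := (Set.ext_iff.mp h f).mpr ⟨(1, 1), by simp⟩
    obtain ⟨⟨c, d⟩, h2⟩ := (Set.ext_iff.mp h e).mp ⟨(1, 1), by simp⟩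
    exact ⟨⟨a, b, h1⟩, c, d, h2⟩
  · rintro ⟨⟨a, b, rfl⟩, c, d, hg⟩
    ext x
    constructor
    · rintro ⟨⟨y, z⟩, rfl⟩
      refine ⟨(y * c, d * z), ?_⟩
      conv_rhs => rw [← hg]
      simp only [mul_assoc]
    · rintro ⟨⟨y, z⟩, rfl⟩
      exact ⟨(y * a, b * z), by simp only [mul_assoc]⟩

/-- Each of `e` and `f` is a right multiple of the other. Right multiplication keeps left arcs and
can only lower labels on the left, so nothing on the left changes. -/
theorem GreenR.sameLeft {e f : OkadaDiagram N} (h : GreenR e f) : SameLeft e f := by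
  obtain ⟨⟨g, h1⟩, g', h2⟩ := (greenR_iff e f).mp h
  intro p hp
  refine ⟨le_antisymm ?_ ?_, fun h3 => ?_, fun h3 => ?_⟩
  · conv_lhs => rw [← h2]
    exact mul_height_le f g' hp
  · conv_lhs => rw [← h1]
    exact mul_height_le e g hp
  · rw [← h1]; exact (mul_of_left_arc e g hp h3).1
  · rw [← h2]; exact (mul_of_left_arc f g' hp h3).1

theorem greenR_mul_mirror (e : OkadaDiagram N) : GreenR e (e * mirror e) :=
  (greenR_iff _ _).mpr ⟨⟨mirror e, rfl⟩, e, mul_mirror_mul e⟩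

/-- Both are R-equivalent to their product with their mirror. These two products are involutive with
the same left half, hence equal. -/
theorem SameLeft.greenR {e f : OkadaDiagram N} (h : SameLeft e f) : GreenR e f := by
  have h2 : e * mirror e = f * mirror f :=
    (((sameLeft_mul_mirror e).symm.trans h).trans
      (sameLeft_mul_mirror f)).eq_of_isInvolutive
      (isInvolutive_mul_mirror e) (isInvolutive_mul_mirror f)
  have h3 := greenR_mul_mirror e
  rw [h2] at h3
  exact Eq.trans h3 (greenR_mul_mirror f).symm

theorem existsUnique_isInvolutive (e : OkadaDiagram N) :
    ∃! f : OkadaDiagram N, GreenR e f ∧ f.IsInvolutive :=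
  ⟨e * mirror e, ⟨greenR_mul_mirror e, isInvolutive_mul_mirror e⟩, fun _ hf =>
    (hf.1.sameLeft.symm.trans (sameLeft_mul_mirror e)).eq_of_isInvolutive hf.2
      (isInvolutive_mul_mirror e)⟩

/-! ### Propagating sets are invariants of two-sided ideals -/

/-- The left ends of propagating arcs with label at least `t`. -/
def propagatingFrom (D : OkadaDiagram N) (t : ℕ) : Finset (Fin (2 * N)) :=
  Finset.univ.filter fun p => (p : ℕ) < N ∧ N ≤ (D.partner p : ℕ) ∧ t ≤ D.height p

theorem mem_propagatingFrom (D : OkadaDiagram N) (t : ℕ) (p : Fin (2 * N)) :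
    p ∈ D.propagatingFrom t ↔ (p : ℕ) < N ∧ N ≤ (D.partner p : ℕ) ∧ t ≤ D.height p := by
  simp [propagatingFrom]

/-- A left vertex that propagates in the product already propagates in `C`, with a label at least as
large. -/
theorem card_propagatingFrom_mul_le (C D : OkadaDiagram N) (t : ℕ) :
    ((C * D).propagatingFrom t).card ≤ (C.propagatingFrom t).card := by
  refine Finset.card_le_card fun p hp => ?_
  rw [mem_propagatingFrom] at hp ⊢
  exact ⟨hp.1, le_of_mul_le C D hp.1 hp.2.1, hp.2.2.trans (mul_height_le C D hp.1)⟩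

/-- The reflection of the right end of a propagating arc is the left end of the mirrored arc. -/
theorem card_propagatingFrom_le_mirror (D : OkadaDiagram N) (t : ℕ) :
    (D.propagatingFrom t).card ≤ ((mirror D).propagatingFrom t).card := by
  refine Finset.card_le_card_of_injOn (fun p => (D.partner p).rev) (fun p hp => ?_) ?_
  · rw [Finset.mem_coe, mem_propagatingFrom] at hp ⊢
    rw [mirror_partner, mirror_height, Fin.rev_rev, D.partner_partner, D.height_partner,
      rev_lt_iff, le_rev_iff]
    exact ⟨hp.2.1, hp.1, hp.2.2⟩
  · intro p _ q _ h
    rw [← D.partner_partner p, Fin.rev_injective h, D.partner_partner]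

theorem card_propagatingFrom_mirror (D : OkadaDiagram N) (t : ℕ) :
    ((mirror D).propagatingFrom t).card = (D.propagatingFrom t).card := by
  refine le_antisymm ?_ (card_propagatingFrom_le_mirror D t)
  have := card_propagatingFrom_le_mirror (mirror D) t
  rwa [mirror_mirror] at this

theorem card_propagatingFrom_mul_mul_le (a e b : OkadaDiagram N) (t : ℕ) :
    ((a * e * b).propagatingFrom t).card ≤ (e.propagatingFrom t).card := by
  refine (card_propagatingFrom_mul_le _ _ t).trans ?_
  -- Multiplication on the left by `a` becomes multiplication on the right after taking mirrors.
  rw [← card_propagatingFrom_mirror, mirror_mul, ← card_propagatingFrom_mirror e]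
  exact card_propagatingFrom_mul_le _ _ t

/-- Multiplication may replace labels by smaller ones, so propagating sets need not shrink under
inclusion, whereas the counts above thresholds do decrease. This recovers the set from the counts.
-/
theorem mem_propLab_iff_card (D : OkadaDiagram N) (t : ℕ) :
    t ∈ D.propLab ↔ (D.propagatingFrom (t + 1)).card < (D.propagatingFrom t).card := by
  have hsub : D.propagatingFrom (t + 1) ⊆ D.propagatingFrom t := fun p hp => by
    rw [mem_propagatingFrom] at hp ⊢
    exact ⟨hp.1, hp.2.1, by omega⟩
  constructor
  · rintro ⟨p, h1, h2, h3⟩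
    refine Finset.card_lt_card (Finset.ssubset_iff_of_subset hsub |>.mpr ⟨p, ?_, ?_⟩)
    · exact (mem_propagatingFrom _ _ _).mpr ⟨h1, h2, h3.ge⟩
    · rw [mem_propagatingFrom]; omega
  · intro h
    obtain ⟨p, h1, h2⟩ := Finset.exists_mem_notMem_of_card_lt_card h
    rw [mem_propagatingFrom] at h1 h2
    exact ⟨p, h1.1, h1.2.1, by omega⟩

theorem GreenJ.propLab_eq {e f : OkadaDiagram N} (h : GreenJ e f) : e.propLab = f.propLab := by
  obtain ⟨⟨a, b, h1⟩, c, d, h2⟩ := (greenJ_iff e f).mp h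
  have key : ∀ t, (e.propagatingFrom t).card = (f.propagatingFrom t).card := fun t =>
    le_antisymm (by conv_lhs => rw [← h2]
                    exact card_propagatingFrom_mul_mul_le c f d t)
      (by conv_lhs => rw [← h1]
          exact card_propagatingFrom_mul_mul_le a e b t)
  ext t
  rw [mem_propLab_iff_card, mem_propLab_iff_card, key, key]

/-! ### Gluing a left half and a right half -/

/-- The diagram that contains the half of a vertex when a left half of `D` is glued to a right
half of `E`. -/
def home (D E : OkadaDiagram N) (p : Fin (2 * N)) : OkadaDiagram N :=
  if (p : ℕ) < N then D else E

/-- The vertex is matched inside its own half. -/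
def IsInner (D E : OkadaDiagram N) (p : Fin (2 * N)) : Prop :=
  ((home D E p).partner p : ℕ) < N ↔ (p : ℕ) < N

/-- The label at a vertex of the glued diagram. -/
def glueHeight (D E : OkadaDiagram N) (p : Fin (2 * N)) : ℕ := (home D E p).height p

/-- Equality of the propagating sets supplies, on the other side, the end of a propagating arc with
the same label. -/
theorem exists_opposite {D E : OkadaDiagram N} (h : D.propLab = E.propLab) {p : Fin (2 * N)}
    (hp : ¬ IsInner D E p) : ∃ q, ¬ IsInner D E q ∧ ((q : ℕ) < N ↔ N ≤ (p : ℕ)) ∧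
      glueHeight D E q = glueHeight D E p := by
  by_cases h1 : (p : ℕ) < N
  · simp only [IsInner, home, if_pos h1, glueHeight] at hp ⊢
    obtain ⟨q, h2, h3, h4⟩ : D.height p ∈ E.propLab := h ▸ ⟨p, h1, by omega, rfl⟩
    refine ⟨E.partner q, ?_, by omega, ?_⟩
    · rw [if_neg (not_lt.mpr h3), E.partner_partner]; omega
    · rw [if_neg (not_lt.mpr h3), E.height_partner, h4]
  · simp only [IsInner, home, if_neg h1, glueHeight] at hp ⊢
    obtain ⟨q, h2, h3, h4⟩ : E.height p ∈ D.propLab :=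
      h ▸ ⟨E.partner p, by omega, by rw [E.partner_partner]; omega, E.height_partner p⟩
    refine ⟨q, ?_, by omega, ?_⟩
    · rw [if_pos h2]; omega
    · rw [if_pos h2, h4]

/-- Labels are strictly monotone along the propagating ends of one side. Hence the choice made in
`gluePartner` is forced, and gluing twice returns to the start. -/
theorem opposite_unique {D E : OkadaDiagram N} {p q : Fin (2 * N)} (hp : ¬ IsInner D E p)
    (hq : ¬ IsInner D E q) (h : (p : ℕ) < N ↔ (q : ℕ) < N)
    (h2 : glueHeight D E p = glueHeight D E q) : p = q := by
  by_cases h1 : (p : ℕ) < N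
  · have h3 := h.mp h1
    simp only [IsInner, home, if_pos h1, if_pos h3, glueHeight] at hp hq h2
    exact eq_of_height_eq D h1 h3 (by omega) (by omega) h2
  · have h3 := mt h.mpr h1
    simp only [IsInner, home, if_neg h1, if_neg h3, glueHeight] at hp hq h2
    exact eq_of_height_eq_right E (by omega) (by omega) (by omega) (by omega) h2

open Classical in
/-- The other end of the arc of the glued diagram through a vertex. -/
noncomputable def gluePartner {D E : OkadaDiagram N} (h : D.propLab = E.propLab)
    (p : Fin (2 * N)) : Fin (2 * N) :=
  if hp : IsInner D E p then (home D E p).partner p else (exists_opposite h hp).choose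

theorem gluePartner_of_inner {D E : OkadaDiagram N} (h : D.propLab = E.propLab)
    {p : Fin (2 * N)} (hp : IsInner D E p) : gluePartner h p = (home D E p).partner p :=
  dif_pos hp

theorem gluePartner_of_not_inner {D E : OkadaDiagram N} (h : D.propLab = E.propLab)
    {p : Fin (2 * N)} (hp : ¬ IsInner D E p) : ¬ IsInner D E (gluePartner h p) ∧
      ((gluePartner h p : ℕ) < N ↔ N ≤ (p : ℕ)) ∧
      glueHeight D E (gluePartner h p) = glueHeight D E p := by
  rw [gluePartner, dif_neg hp]
  exact (exists_opposite h hp).choose_spec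

theorem home_partner_of_inner {D E : OkadaDiagram N} {p : Fin (2 * N)} (hp : IsInner D E p) :
    home D E ((home D E p).partner p) = home D E p ∧ IsInner D E ((home D E p).partner p) := by
  have h1 : home D E ((home D E p).partner p) = home D E p := by
    unfold IsInner at hp
    conv_lhs => rw [home]
    conv_rhs => rw [home]
    simp only [hp]
  refine ⟨h1, ?_⟩
  unfold IsInner at hp ⊢
  rw [h1, (home D E p).partner_partner]
  exact hp.symm

theorem gluePartner_gluePartner {D E : OkadaDiagram N} (h : D.propLab = E.propLab)
    (p : Fin (2 * N)) : gluePartner h (gluePartner h p) = p := by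
  by_cases hp : IsInner D E p
  · obtain ⟨h1, h2⟩ := home_partner_of_inner hp
    rw [gluePartner_of_inner h hp, gluePartner_of_inner h h2, h1,
      (home D E p).partner_partner]
  · obtain ⟨h1, h2, h3⟩ := gluePartner_of_not_inner h hp
    obtain ⟨h4, h5, h6⟩ := gluePartner_of_not_inner h h1
    -- Two passages to the other side with the label kept lead to a propagating end on the side of
    -- `p` with the label of `p`.
    exact opposite_unique h4 hp (by omega) (h6.trans h3)

theorem glueHeight_gluePartner {D E : OkadaDiagram N} (h : D.propLab = E.propLab)
    (p : Fin (2 * N)) : glueHeight D E (gluePartner h p) = glueHeight D E p := by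
  by_cases hp : IsInner D E p
  · rw [gluePartner_of_inner h hp, glueHeight, (home_partner_of_inner hp).1,
      (home D E p).height_partner]
    rfl
  · exact (gluePartner_of_not_inner h hp).2.2

/-- The two ends of an arc have positions of opposite parity. A left position `p` has absolute value
`p + 1` and a right position `q` has `2 * N - q`, so the absolute values at the ends of a
propagating arc agree modulo 2. Either end then determines the parity of the label, which is needed
when the ends come from different diagrams. -/
theorem height_parity_of_propagating (D : OkadaDiagram N) {p : Fin (2 * N)}
    (h : (D.partner p : ℕ) < N ↔ N ≤ (p : ℕ)) : D.height p ≡ vertexAbs p [MOD 2] := by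
  have h1 := D.height_parity p
  have h2 : (D.partner p : ℕ) ≡ (p : ℕ) + 1 [MOD 2] := by
    rw [← ZMod.natCast_eq_natCast_iff]; push_cast; exact cast_partner D p
  have := p.isLt
  have := (D.partner p).isLt
  unfold vertexAbs Nat.ModEq at *
  split_ifs at * <;> omega

/-- The left half of `D` glued to the right half of `E`. -/
noncomputable def glue {D E : OkadaDiagram N} (h : D.propLab = E.propLab) : OkadaDiagram N where
  partner := gluePartner h
  height := glueHeight D E
  partner_partner := gluePartner_gluePartner h
  partner_ne p hp := by
    by_cases hi : IsInner D E p
    · rw [gluePartner_of_inner h hi] at hp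
      exact (home D E p).partner_ne p hp
    · have := (gluePartner_of_not_inner h hi).2.1
      rw [hp] at this; omega
  height_partner := glueHeight_gluePartner h
  noncrossing a c h1 h2 h3 := by
    have h1' : (a : ℕ) < c := h1
    have h2' : (c : ℕ) < gluePartner h a := h2
    have h3' : (gluePartner h a : ℕ) < gluePartner h c := h3
    -- If the arc of `a` stays in its half, everything under it lies in the same half, and the claim
    -- is that of one diagram.
    by_cases ha : IsInner D E a
    · have hca : home D E c = home D E a := by
        have ha' := ha
        rw [gluePartner_of_inner h ha] at h2'
        unfold IsInner at ha'
        have : (c : ℕ) < N ↔ (a : ℕ) < N := by omega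
        simp only [home, this]
      rw [gluePartner_of_inner h ha] at h2 h2' h3 h3'
      have hb := partner_mem_between _ h1 h2
      have hc : IsInner D E c := by
        have hb1 : (a : ℕ) < ((home D E a).partner c) := hb.1
        have hb2 : ((home D E a).partner c : ℕ) < (home D E a).partner a := hb.2
        unfold IsInner at ha ⊢
        rw [hca]; omega
      rw [gluePartner_of_inner h hc, hca] at h3
      exact lt_asymm hb.2 h3
    · obtain ⟨i1, i2, i3⟩ := gluePartner_of_not_inner h ha
      have haN : (a : ℕ) < N := by omega
      have hpa : N ≤ (gluePartner h a : ℕ) := by omega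
      by_cases hc : IsInner D E c
      · rw [gluePartner_of_inner h hc] at h3 h3'
        unfold IsInner at hc i1
        have hcN : ¬ (c : ℕ) < N := by omega
        rw [home, if_neg hcN] at h3 h3' hc
        rw [home, if_neg (not_lt.mpr hpa)] at i1
        -- Here `c` is on the right and its arc in `E` covers the right end of the glued arc. That
        -- end propagates in `E`, so its partner would have to be both under the arc of `c` and on
        -- the left.
        have hb : (c : ℕ) < E.partner (gluePartner h a) := (partner_mem_between E h2 h3).1
        omega
      · obtain ⟨j1, j2, j3⟩ := gluePartner_of_not_inner h hc
        have hcN : (c : ℕ) < N := by omega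
        have hpc : ¬ (gluePartner h c : ℕ) < N := by omega
        simp only [IsInner, glueHeight, home, if_pos haN, if_pos hcN, if_neg (not_lt.mpr hpa),
          if_neg hpc] at ha hc i1 j1 i3 j3
        -- For two glued arcs a crossing would make the labels increase from `a` to `c` on the left
        -- and decrease on the right, although the labels at joined ends agree.
        have k1 := height_lt_of_propagating D hcN (by omega) (by omega) h1
        have k2 := height_lt_of_propagating_right E hpa (by omega) (by omega) h3
        omega
  one_le_height p := (home D E p).one_le_height p
  height_le p := by
    refine le_min (((home D E p).height_le p).trans (min_le_left _ _)) ?_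
    rw [← glueHeight_gluePartner h]
    exact ((home D E _).height_le _).trans (min_le_left _ _)
  height_parity p := by
    by_cases hp : IsInner D E p
    · rw [gluePartner_of_inner h hp]; exact (home D E p).height_parity p
    · obtain ⟨i1, i2, i3⟩ := gluePartner_of_not_inner h hp
      unfold IsInner at hp i1
      -- The label is congruent to the absolute value at each end, hence to their minimum.
      have k1 := height_parity_of_propagating (home D E p) (p := p) (by omega)
      have k2 := height_parity_of_propagating (home D E (gluePartner h p))
        (p := gluePartner h p) (by omega)
      unfold glueHeight at i3 ⊢
      unfold Nat.ModEq at *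
      omega
  height_lt_of_nested a c h1 h2 h3 := by
    have h1' : (c : ℕ) < a := h1
    have h2' : (a : ℕ) < gluePartner h a := h2
    have h3' : (gluePartner h a : ℕ) < gluePartner h c := h3
    by_cases hc : IsInner D E c
    · rw [gluePartner_of_inner h hc] at h3 h3'
      have hc' := hc
      unfold IsInner at hc
      have hac : home D E a = home D E c := by
        have : (a : ℕ) < N ↔ (c : ℕ) < N := by omega
        simp only [home, this]
      have hb := partner_mem_between (home D E c) h1 (h2.trans h3)
      have hb1 : (c : ℕ) < (home D E c).partner a := hb.1
      have hb2 : ((home D E c).partner a : ℕ) < (home D E c).partner c := hb.2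
      have ha : IsInner D E a := by unfold IsInner; rw [hac]; omega
      rw [gluePartner_of_inner h ha, hac] at h2 h3
      unfold glueHeight
      rw [hac]
      exact (home D E c).height_lt_of_nested a c h1 h2 h3
    · obtain ⟨i1, i2, i3⟩ := gluePartner_of_not_inner h hc
      have hcN : (c : ℕ) < N := by omega
      have hpc : ¬ (gluePartner h c : ℕ) < N := by omega
      unfold IsInner at hc i1
      rw [home, if_pos hcN] at hc
      rw [home, if_neg hpc] at i1
      by_cases ha : IsInner D E a
      · rw [gluePartner_of_inner h ha] at h2 h2' h3 h3'
        unfold IsInner at ha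
        -- An inner arc of `a` lies under the glued arc of `c`. On the left the enclosing arc is the
        -- propagating arc of `D` at `c`; on the right it is the one of `E` at the other glued end,
        -- which has the same label.
        by_cases haN : (a : ℕ) < N
        · rw [home, if_pos haN] at ha h2
          simp only [glueHeight, home, if_pos haN, if_pos hcN]
          exact D.height_lt_of_nested a c h1 h2 (by rw [Fin.lt_def]; omega)
        · rw [home, if_neg haN] at ha h2 h3
          rw [← i3]
          simp only [glueHeight, home, if_neg haN, if_neg hpc]
          rw [← E.height_partner (gluePartner h c)]
          exact E.height_lt_of_nested a _ (by rw [Fin.lt_def]; omega) h2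
            (by rwa [E.partner_partner])
      · obtain ⟨j1, j2, j3⟩ := gluePartner_of_not_inner h ha
        have haN : (a : ℕ) < N := by omega
        unfold IsInner at ha
        rw [home, if_pos haN] at ha
        simp only [glueHeight, home, if_pos haN, if_pos hcN]
        exact height_lt_of_propagating D haN (by omega) (by omega) h1

theorem sameLeft_glue {D E : OkadaDiagram N} (h : D.propLab = E.propLab) :
    SameLeft D (glue h) := by
  intro p hp
  have hh : home D E p = D := if_pos hp
  refine ⟨by change _ = (home D E p).height p; rw [hh], fun h1 => ?_, fun h1 => ?_⟩
  · have hi : IsInner D E p := by unfold IsInner; rw [hh]; omega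
    exact (gluePartner_of_inner h hi).trans (by rw [hh])
  · by_cases hi : IsInner D E p
    · exact ((gluePartner_of_inner h hi).trans (by rw [hh])).symm
    · have h2 : (gluePartner h p : ℕ) < N := h1
      have := (gluePartner_of_not_inner h hi).2.1
      omega

theorem sameLeft_mirror_glue {D E : OkadaDiagram N} (h : D.propLab = E.propLab) :
    SameLeft (mirror E) (mirror (glue h)) := by
  intro p hp
  have hq : ¬ (p.rev : ℕ) < N := by rw [not_lt, le_rev_iff]; exact hp
  have hh : home D E p.rev = E := if_neg hq
  simp only [mirror_partner, mirror_height, rev_lt_iff, Fin.rev_inj]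
  refine ⟨by change _ = (home D E p.rev).height p.rev; rw [hh], fun h1 => ?_, fun h1 => ?_⟩
  · have hi : IsInner D E p.rev := by unfold IsInner; rw [hh]; omega
    exact (gluePartner_of_inner h hi).trans (by rw [hh])
  · by_cases hi : IsInner D E p.rev
    · exact ((gluePartner_of_inner h hi).trans (by rw [hh])).symm
    · have h2 : N ≤ (gluePartner h p.rev : ℕ) := h1
      have := (gluePartner_of_not_inner h hi).2.1
      omega

theorem greenJ_of_greenR {e f : OkadaDiagram N} (h : GreenR e f) : GreenJ e f := by
  obtain ⟨⟨g, h1⟩, g', h2⟩ := (greenR_iff e f).mp h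
  exact (greenJ_iff e f).mpr ⟨⟨1, g, by rw [one_mul, h1]⟩, 1, g', by rw [one_mul, h2]⟩

/-- The mirror exchanges left and right multiples, so the hypothesis says that `e` and `f` generate
the same left ideal. -/
theorem greenJ_of_greenR_mirror {e f : OkadaDiagram N} (h : GreenR (mirror e) (mirror f)) :
    GreenJ e f := by
  obtain ⟨⟨g, h1⟩, g', h2⟩ := (greenR_iff _ _).mp h
  have h1 := congrArg mirror h1
  have h2 := congrArg mirror h2
  simp only [mirror_mul, mirror_mirror] at h1 h2
  exact (greenJ_iff e f).mpr ⟨⟨_, 1, by rw [mul_one, h1]⟩, _, 1, by rw [mul_one, h2]⟩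

/-- The propagating set determines the `J`-class. -/
theorem greenJ_iff_propLab_eq (e f : OkadaDiagram N) : GreenJ e f ↔ e.propLab = f.propLab := by
  refine ⟨GreenJ.propLab_eq, fun h => ?_⟩
  -- The glued diagram is the link: it shares its left half with `e` and its right half with `f`.
  exact Eq.trans (greenJ_of_greenR (sameLeft_glue h).greenR)
    (greenJ_of_greenR_mirror (sameLeft_mirror_glue h).greenR).symm

/-! ### Propagating sets are Fibonacci sets -/

/-- The propagating set as a finite set. -/
def propFinset (D : OkadaDiagram N) : Finset ℕ := (D.propagatingFrom 0).image D.height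

theorem coe_propFinset (D : OkadaDiagram N) : (D.propFinset : Set ℕ) = D.propLab := by
  ext t
  simp [propFinset, propLab, mem_propagatingFrom, and_assoc]

theorem injOn_height_propagatingFrom (D : OkadaDiagram N) (t : ℕ) :
    Set.InjOn D.height (D.propagatingFrom t) := by
  intro p hp q hq h
  rw [Finset.mem_coe, mem_propagatingFrom] at hp hq
  exact eq_of_height_eq D hp.1 hq.1 hp.2.1 hq.2.1 h

/-- The propagating arcs that start in an initial segment closed under left arcs have the parity
of its length. -/
theorem card_propagatingFrom_lt (D : OkadaDiagram N) {b : ℕ} (hb : b ≤ N)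
    (hclosed : ∀ y : Fin (2 * N), (y : ℕ) < b → (D.partner y : ℕ) < N →
      (D.partner y : ℕ) < b) :
    ((D.propagatingFrom 0).filter fun y : Fin (2 * N) => (y : ℕ) < b).card ≡ b [MOD 2] := by
  -- The vertices of the segment that lie on left arcs are matched among themselves, so their number
  -- is even.
  have h : (∑ y : Fin (2 * N), if (y : ℕ) < b ∧ (D.partner y : ℕ) < N then (1 : ZMod 2) else 0)
      = 0 := by
    convert sum_eq_zero_of_closed D (fun y => (y : ℕ) < b ∧ (D.partner y : ℕ) < N)
      (fun y hy => ⟨hclosed y hy.1 hy.2, by rw [D.partner_partner]; omega⟩)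
  have hcard : (Finset.univ.filter fun y : Fin (2 * N) => (y : ℕ) < b).card = b := by
    rw [Fin.card_filter_val_lt]; omega
  conv_rhs => rw [← hcard]
  rw [← ZMod.natCast_eq_natCast_iff]
  have e1 : (((D.propagatingFrom 0).filter fun y : Fin (2 * N) => (y : ℕ) < b).card : ZMod 2) =
      ∑ y : Fin (2 * N), if (y : ℕ) < b ∧ ¬ (D.partner y : ℕ) < N then (1 : ZMod 2) else 0 := by
    rw [Finset.sum_boole]
    congr 2
    ext y
    simp only [Finset.mem_filter, mem_propagatingFrom, Finset.mem_univ, true_and]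
    omega
  have e2 : (((Finset.univ.filter fun y : Fin (2 * N) => (y : ℕ) < b).card : ℕ) : ZMod 2) =
      (∑ y : Fin (2 * N), if (y : ℕ) < b ∧ ¬ (D.partner y : ℕ) < N then (1 : ZMod 2) else 0) +
        ∑ y : Fin (2 * N), if (y : ℕ) < b ∧ (D.partner y : ℕ) < N then (1 : ZMod 2) else 0 := by
    rw [← Finset.sum_add_distrib, ← Finset.sum_boole]
    refine Finset.sum_congr rfl fun y _ => ?_
    by_cases h1 : (y : ℕ) < b <;> by_cases h2 : (D.partner y : ℕ) < N <;> simp [h1, h2]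
  rw [e1, e2, h, add_zero]

/-- The labels up to that of a propagating arc at `p` belong to the propagating arcs starting at or
before `p`. The initial segment ending at `p` has `p + 1` vertices and is closed under left arcs, so
there are `p + 1` such arcs modulo 2, which is also the parity of the label at `p`. The segment of
all left vertices gives the parity of the cardinality. -/
theorem isFibonacciSet_propFinset (D : OkadaDiagram N) : IsFibonacciSet N D.propFinset := by
  refine ⟨?_, ?_, ?_⟩
  · intro s hs
    obtain ⟨p, hp, rfl⟩ := Finset.mem_image.mp hs
    rw [mem_propagatingFrom] at hp
    have h1 := D.one_le_height p
    have h2 := (D.height_le p).trans (min_le_left _ _)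
    rw [vertexAbs, if_pos hp.1] at h2
    exact Finset.mem_Icc.mpr ⟨h1, by omega⟩
  · rw [propFinset, Finset.card_image_of_injOn (injOn_height_propagatingFrom D 0)]
    have := card_propagatingFrom_lt D (b := N) le_rfl (fun y _ h => h)
    rwa [Finset.filter_true_of_mem (fun y hy => ((mem_propagatingFrom D 0 y).mp hy).1)] at this
  · intro s hs
    obtain ⟨p, hp, rfl⟩ := Finset.mem_image.mp hs
    rw [propFinset, Finset.filter_image, Finset.card_image_of_injOn
      ((injOn_height_propagatingFrom D 0).mono (Finset.coe_subset.mpr (Finset.filter_subset _ _)))]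
    have hp' := (mem_propagatingFrom D 0 p).mp hp
    have e : (D.propagatingFrom 0).filter (fun y => D.height y ≤ D.height p) =
        (D.propagatingFrom 0).filter (fun y : Fin (2 * N) => (y : ℕ) < (p : ℕ) + 1) := by
      refine Finset.filter_congr fun y hy => ?_
      have hy' := (mem_propagatingFrom D 0 y).mp hy
      constructor
      · intro h
        by_contra h2
        have := height_lt_of_propagating D hy'.1 hp'.2.1 hy'.2.1
          (by rw [Fin.lt_def]; omega)
        omega
      · intro h
        rcases eq_or_lt_of_le (show y ≤ p by rw [Fin.le_def]; omega) with h2 | h2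
        · rw [h2]
        · exact (height_lt_of_propagating D hp'.1 hy'.2.1 hp'.2.1 h2).le
    rw [e]
    refine Nat.ModEq.trans ?_ (card_propagatingFrom_lt D (b := (p : ℕ) + 1) (by omega) ?_).symm
    · have := height_parity_of_propagating D (p := p) (by omega)
      rwa [vertexAbs, if_pos hp'.1] at this
    · intro y h1 h2
      -- A left arc leaving the segment would pass over `p` and enclose its arc, but that arc ends
      -- on the right.
      by_contra h3
      have h4 : p < D.partner y := by rw [Fin.lt_def]; omega
      rcases eq_or_lt_of_le (show y ≤ p by rw [Fin.le_def]; omega) with h5 | h5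
      · rw [h5] at h2; omega
      · have h6 : (D.partner p : ℕ) < D.partner y := (partner_mem_between D h5 h4).2
        omega

/-! ### Products of distant elementary diagrams -/

theorem elementary_partner_val (i : Fin (N - 1)) (p : Fin (2 * N)) :
    ((elementary i).partner p : ℕ) =
      if (p : ℕ) = i then (i : ℕ) + 1 else if (p : ℕ) = i + 1 then (i : ℕ)
      else if (p : ℕ) + 1 + i = 2 * N then 2 * N - 2 - i
      else if (p : ℕ) + 2 + i = 2 * N then 2 * N - 1 - i else 2 * N - 1 - p :=
  elemPartner_val i p

theorem elementary_of_ne (i : Fin (N - 1)) {p : Fin (2 * N)} (hp : (p : ℕ) < N)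
    (h1 : (p : ℕ) ≠ i) (h2 : (p : ℕ) ≠ i + 1) :
    (elementary i).partner p = p.rev ∧ (elementary i).height p = p + 1 := by
  have := i.isLt
  constructor
  · rw [Fin.ext_iff, elementary_partner_val, Fin.val_rev]
    split_ifs <;> omega
  · simp only [elementary, vertexAbs]
    split_ifs <;> omega

theorem elementary_rev_of_ne (i : Fin (N - 1)) {p : Fin (2 * N)} (hp : (p : ℕ) < N)
    (h1 : (p : ℕ) ≠ i) (h2 : (p : ℕ) ≠ i + 1) : (elementary i).partner p.rev = p := by
  rw [← (elementary_of_ne i hp h1 h2).1, (elementary i).partner_partner]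

/-- For distant indices the pairs of positions `i`, `i + 1` are disjoint and the factors do not
interfere, so the left half of the product is read off the list. Labels are recorded only at the
vertices outside these pairs, since the others do not propagate. -/
theorem prod_elementary (l : List (Fin (N - 1)))
    (hl : l.Pairwise fun i j : Fin (N - 1) => (i : ℕ) + 1 < j ∨ (j : ℕ) + 1 < i) (p : Fin (2 * N))
    (hp : (p : ℕ) < N) :
    (∀ i ∈ l, (p : ℕ) = i → ((l.map elementary).prod.partner p : ℕ) = i + 1) ∧
    (∀ i ∈ l, (p : ℕ) = i + 1 → ((l.map elementary).prod.partner p : ℕ) = i) ∧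
    ((∀ i ∈ l, (p : ℕ) ≠ i ∧ (p : ℕ) ≠ i + 1) → (l.map elementary).prod.partner p = p.rev ∧
      (l.map elementary).prod.height p = p + 1) := by
  induction l with
  | nil =>
    refine ⟨by simp, by simp, fun _ => ⟨rfl, ?_⟩⟩
    change vertexAbs p = _
    rw [vertexAbs, if_pos hp]
  | cons k l ih =>
    rw [List.pairwise_cons] at hl
    obtain ⟨ih1, ih2, ih3⟩ := ih hl.2
    rw [List.map_cons, List.prod_cons]
    set D := (l.map elementary).prod
    have hk := k.isLt
    have hv := elementary_partner_val k p
    -- A left arc of `D` away from the pair of `k` is reached and left through horizontal arcs of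
    -- the first factor, so it reappears in the product.
    have bounce : (p : ℕ) ≠ k → (p : ℕ) ≠ k + 1 → (D.partner p : ℕ) ≠ k →
        (D.partner p : ℕ) ≠ k + 1 → (D.partner p : ℕ) < N →
        (elementary k * D).partner p = D.partner p := by
      intro h1 h2 h3 h4 h5
      have e1 := (elementary_of_ne k hp h1 h2).1
      have e2 := elementary_rev_of_ne k h5 h3 h4
      have := mul_of_bounce (elementary k) D hp (by rw [e1]; exact (le_rev_iff p).mpr hp)
        (by rw [e1, Fin.rev_rev]; exact h5) (by rw [e1, Fin.rev_rev, e2]; exact h5)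
      rwa [e1, Fin.rev_rev, e2] at this
    refine ⟨?_, ?_, ?_⟩
    · intro i hi hpi
      rcases List.mem_cons.mp hi with rfl | hi
      · rw [if_pos hpi] at hv
        rw [(mul_of_left_arc (elementary i) D hp (by omega)).1, hv]
      · have := hl.1 i hi
        have := ih1 i hi hpi
        rw [bounce (by omega) (by omega) (by omega) (by omega) (by omega), this]
    · intro i hi hpi
      rcases List.mem_cons.mp hi with rfl | hi
      · rw [if_neg (by omega), if_pos hpi] at hv
        rw [(mul_of_left_arc (elementary i) D hp (by omega)).1, hv]
      · have := hl.1 i hi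
        have := ih2 i hi hpi
        rw [bounce (by omega) (by omega) (by omega) (by omega) (by omega), this]
    · intro h
      obtain ⟨h1, h2⟩ := h k List.mem_cons_self
      obtain ⟨e1, e2⟩ := elementary_of_ne k hp h1 h2
      obtain ⟨e3, e4⟩ := ih3 fun i hi => h i (List.mem_cons_of_mem k hi)
      have := mul_of_through (elementary k) D hp (by rw [e1]; exact (le_rev_iff p).mpr hp)
        (by rw [e1, Fin.rev_rev, e3]; exact (le_rev_iff p).mpr hp)
      rwa [e1, Fin.rev_rev, e3, e2, e4, min_self] at this

end OkadaDiagram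

/-! ### Fibonacci sets and free sets -/

/-- The distance from `j` to the last element of `S` before `j`. -/
def gap (S : Finset ℕ) (j : ℕ) : ℕ := j - (S.filter (fun s => s < j)).sup id

theorem mem_freeSet {N : ℕ} {S : Finset ℕ} {i : Fin (N - 1)} :
    i ∈ freeSet N S ↔ (i : ℕ) + 1 ∉ S ∧ Odd (gap S (i + 1)) := by
  simp [freeSet, gap]

/-- With the next lemma this gives a recursion: the gap restarts at 1 after an element of `S` and
otherwise grows by 1. The parity arguments below use only this and the value 0 at 0. -/
theorem gap_succ_of_mem {S : Finset ℕ} {j : ℕ} (h : j ∈ S) : gap S (j + 1) = 1 := by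
  have : (S.filter (fun s => s < j + 1)).sup id = j := by
    apply le_antisymm
    · refine Finset.sup_le fun s hs => ?_
      have := (Finset.mem_filter.mp hs).2
      simp only [id]; omega
    · exact Finset.le_sup (f := id) (Finset.mem_filter.mpr ⟨h, by omega⟩)
  rw [gap, this]; omega

theorem gap_succ_of_notMem {S : Finset ℕ} {j : ℕ} (h : j ∉ S) :
    gap S (j + 1) = gap S j + 1 := by
  have e : S.filter (fun s => s < j + 1) = S.filter (fun s => s < j) := by
    refine Finset.filter_congr fun s hs => ?_
    have : s ≠ j := fun e => h (e ▸ hs)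
    omega
  -- This bound makes the truncated subtractions exact; it covers the empty supremum 0 as well.
  have h2 : (S.filter (fun s => s < j)).sup id ≤ j := by
    refine Finset.sup_le fun s hs => ?_
    exact (Finset.mem_filter.mp hs).2.le
  rw [gap, gap, e]; omega

theorem gap_zero (S : Finset ℕ) : gap S 0 = 0 := by simp [gap]

/-- For a Fibonacci set, `j` minus its gap has the parity of the number of elements before `j`. -/
theorem IsFibonacciSet.gap_modEq {N : ℕ} {S : Finset ℕ} (hS : IsFibonacciSet N S) (j : ℕ) :
    gap S j + (S.filter (fun s => s < j)).card ≡ j [MOD 2] := by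
  induction j with
  | zero => simp [gap_zero]; rfl
  | succ j ih =>
    by_cases h : j ∈ S
    · have h1 := hS.2.2 j h
      have e : S.filter (fun s => s < j + 1) = S.filter (fun s => s ≤ j) :=
        Finset.filter_congr fun s _ => Nat.lt_succ_iff
      rw [gap_succ_of_mem h, e]
      unfold Nat.ModEq at *
      omega
    · have e : S.filter (fun s => s < j + 1) = S.filter (fun s => s < j) := by
        refine Finset.filter_congr fun s hs => ?_
        have : s ≠ j := fun e => h (e ▸ hs)
        omega
      rw [gap_succ_of_notMem h, e]
      unfold Nat.ModEq at *
      omega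

/-- The element of index l has the parity of l and is preceded by l - 1 elements, so `gap_modEq`
makes its gap odd. -/
theorem IsFibonacciSet.odd_gap {N : ℕ} {S : Finset ℕ} (hS : IsFibonacciSet N S) {j : ℕ}
    (h : j ∈ S) : Odd (gap S j) := by
  have h1 := hS.2.2 j h
  have h2 := hS.gap_modEq j
  have e : S.filter (fun s => s ≤ j) = insert j (S.filter (fun s => s < j)) := by
    ext s
    simp only [Finset.mem_filter, Finset.mem_insert]
    constructor
    · rintro ⟨h3, h4⟩
      rcases h4.eq_or_lt with h5 | h5
      · exact Or.inl h5
      · exact Or.inr ⟨h3, h5⟩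
    · rintro (rfl | ⟨h3, h4⟩)
      · exact ⟨h, le_rfl⟩
      · exact ⟨h3, h4.le⟩
  rw [e, Finset.card_insert_of_notMem (by simp)] at h1
  rw [Nat.odd_iff]
  unfold Nat.ModEq at *
  omega

/-- Since the cardinality of `S` has the parity of `N`, the integer `N + 1` behaves like one more
element of the Fibonacci set. -/
theorem IsFibonacciSet.odd_gap_succ {N : ℕ} {S : Finset ℕ} (hS : IsFibonacciSet N S) :
    Odd (gap S (N + 1)) := by
  have h := hS.gap_modEq (N + 1)
  have e : S.filter (fun s => s < N + 1) = S :=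
    Finset.filter_true_of_mem fun s hs => by
      have := Finset.mem_Icc.mp (hS.1 hs); omega
  have h2 := hS.2.1
  rw [e] at h
  rw [Nat.odd_iff]
  unfold Nat.ModEq at *
  omega

/-- Outside `S` the gap grows by 1, so an odd gap is followed by an even one and two consecutive
indices cannot both be free. -/
theorem freeSet_distant {N : ℕ} {S : Finset ℕ} {i j : Fin (N - 1)} (hi : i ∈ freeSet N S)
    (hj : j ∈ freeSet N S) (h : i < j) :
    (i : ℕ) + 1 < j := by
  by_contra h2
  have h3 : (j : ℕ) = i + 1 := by
    have : (i : ℕ) < j := h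
    omega
  rw [mem_freeSet] at hi hj
  have := gap_succ_of_notMem hi.1
  rw [h3, this] at hj
  have h4 := hj.2
  rw [Nat.odd_iff] at *
  have := hi.2
  omega

/-- Each `j ∈ {1, …, N}` lies in `S`, or in the free set, or follows an element of the free set. -/
theorem IsFibonacciSet.mem_iff {N : ℕ} {S : Finset ℕ} (hS : IsFibonacciSet N S) {p : ℕ}
    (hp : p < N) : p + 1 ∈ S ↔ ∀ i ∈ freeSet N S, p ≠ i ∧ p ≠ i + 1 := by
  constructor
  · intro h i hi
    rw [mem_freeSet] at hi
    refine ⟨fun e => hi.1 (e ▸ h), fun e => ?_⟩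
    -- The integer after a free index has even gap, whereas elements of `S` have odd gaps.
    have h1 := hS.odd_gap h
    rw [e, gap_succ_of_notMem hi.1, Nat.odd_add_one] at h1
    exact h1 hi.2
  · intro h
    by_contra hn
    by_cases ho : Odd (gap S (p + 1))
    -- An odd gap outside `S` makes `p + 1` itself free, unless `p + 1 = N`. In that case the gap at
    -- `N + 1` would be even.
    · by_cases hpN : p < N - 1
      · exact (h ⟨p, hpN⟩ (mem_freeSet.mpr ⟨hn, ho⟩)).1 rfl
      · have h2 := hS.odd_gap_succ
        rw [show N = p + 1 by omega, gap_succ_of_notMem hn, Nat.odd_add_one] at h2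
        exact h2 ho
    -- An even gap at `p + 1` means that `p` is outside `S` with odd gap, hence nonzero and free;
    -- its index in `Fin (N - 1)` is `p - 1`.
    · have h1 : p ∉ S := fun hps => ho (by rw [gap_succ_of_mem hps]; exact odd_one)
      rw [gap_succ_of_notMem h1, Nat.odd_add_one, not_not] at ho
      obtain ⟨q, rfl⟩ : ∃ q, p = q + 1 := by
        cases p with
        | zero => rw [gap_zero] at ho; exact absurd ho (by decide)
        | succ q => exact ⟨q, rfl⟩
      exact (h ⟨q, by omega⟩ (mem_freeSet.mpr ⟨h1, ho⟩)).2 rfl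

/-! ### Propagating sets of free elements, and the theorem -/

namespace OkadaDiagram

/-- By `prod_elementary` the propagating arcs start at the positions `p` outside all pairs of the
free set and carry the labels `p + 1`; by `IsFibonacciSet.mem_iff` these labels form `S`. -/
theorem propLab_freeElement {N : ℕ} {S : Finset ℕ} (hS : IsFibonacciSet N S) :
    (freeElement N S).propLab = S := by
  have hl : ((freeSet N S).sort (fun a b => a ≤ b)).Pairwise
      fun i j : Fin (N - 1) => (i : ℕ) + 1 < j ∨ (j : ℕ) + 1 < i := by
    refine List.Pairwise.imp_of_mem (fun {i j} hi hj h => ?_)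
      (Finset.sortedLT_sort (freeSet N S)).pairwise
    exact Or.inl (freeSet_distant ((Finset.mem_sort _).mp hi) ((Finset.mem_sort _).mp hj) h)
  have key := prod_elementary _ hl
  simp only [Finset.mem_sort] at key
  change ∀ p : Fin (2 * N), (p : ℕ) < N →
    (∀ i ∈ freeSet N S, (p : ℕ) = i → ((freeElement N S).partner p : ℕ) = i + 1) ∧
    (∀ i ∈ freeSet N S, (p : ℕ) = i + 1 → ((freeElement N S).partner p : ℕ) = i) ∧
    ((∀ i ∈ freeSet N S, (p : ℕ) ≠ i ∧ (p : ℕ) ≠ i + 1) →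
      (freeElement N S).partner p = p.rev ∧ (freeElement N S).height p = p + 1) at key
  ext t
  constructor
  · rintro ⟨p, h1, h2, rfl⟩
    obtain ⟨k1, k2, k3⟩ := key p h1
    have h : ∀ i ∈ freeSet N S, (p : ℕ) ≠ i ∧ (p : ℕ) ≠ i + 1 := by
      intro i hi
      have := i.isLt
      exact ⟨fun e => by have := k1 i hi e; omega, fun e => by have := k2 i hi e; omega⟩
    rw [(k3 h).2]
    exact (hS.mem_iff h1).mpr h
  · intro ht
    obtain ⟨h1, h2⟩ := Finset.mem_Icc.mp (hS.1 ht)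
    obtain ⟨q, rfl⟩ : ∃ q, t = q + 1 := ⟨t - 1, by omega⟩
    have hq : ((⟨q, by omega⟩ : Fin (2 * N)) : ℕ) < N := h2
    obtain ⟨e1, e2⟩ := (key ⟨q, by omega⟩ hq).2.2 ((hS.mem_iff h2).mp ht)
    exact ⟨⟨q, by omega⟩, hq, by rw [e1]; exact (le_rev_iff _).mpr hq, e2⟩

/-- The propagating set of `e` is a Fibonacci set, and its free element has the same propagating
set. Uniqueness holds because a free element's propagating set is the Fibonacci set that defines it.
-/
theorem existsUnique_isFree {N : ℕ} (e : OkadaDiagram N) :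
    ∃! f : OkadaDiagram N, GreenJ e f ∧ f.IsFree := by
  have hS := isFibonacciSet_propFinset e
  refine ⟨freeElement N e.propFinset, ⟨?_, _, hS, rfl⟩, ?_⟩
  · rw [greenJ_iff_propLab_eq, propLab_freeElement hS, coe_propFinset]
  · rintro f ⟨h, T, hT, rfl⟩
    rw [greenJ_iff_propLab_eq, propLab_freeElement hT, ← coe_propFinset, Finset.coe_inj] at h
    rw [h]

end OkadaDiagram

theorem mainTheorem7 (N : ℕ) :
    (∀ e : OkadaDiagram N, ∃! f : OkadaDiagram N, OkadaDiagram.GreenR e f ∧ f.IsInvolutive) ∧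
    (∀ e : OkadaDiagram N, ∃! f : OkadaDiagram N, OkadaDiagram.GreenJ e f ∧ f.IsFree) ∧
    (∀ e f : OkadaDiagram N, f.IsFree →
      (OkadaDiagram.GreenJ e f ↔ f.propLab = e.propLab)) :=
  ⟨OkadaDiagram.existsUnique_isInvolutive, OkadaDiagram.existsUnique_isFree, fun e f _ =>
    (OkadaDiagram.greenJ_iff_propLab_eq e f).trans eq_comm⟩
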